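/- Let $n\ge 3$, and let $K$ be a field of characteristic $0$ containing elements $r,s$ that are algebraically independent over $\mathbb Q$, with chosen square roots $r^{1/2},s^{1/2}\in K$ (e.g. $K=\mathbb Q(r^{1/2},s^{1/2})$); powers $r^{k/2}$, $s^{k/2}$ are formed from these. Let $\epsilon_1,\dots,\epsilon_n$ be an orthonormal basis of $\mathbb R^n$, $\alpha_i=\epsilon_i-\epsilon_{i+1}$ $(i<n)$, $\alpha_n=\epsilon_{n-1}+\epsilon_n$, $a_{ij}=(\alpha_i,\alpha_j)$. Set $A_{ji}=(\epsilon_j,\alpha_i)$, $B_{ji}=(\epsilon_{j+1},\alpha_i)$ for $j<n$; $A_{ni}=(\epsilon_{n-1},\alpha_i)$, $B_{ni}=-(\epsilon_n,\alpha_i)$ for $i\ne n-1$; and $A_{n,n-1}=(\epsilon_n,\alpha_{n-1})$, $B_{n,n-1}=-(\epsilon_{n-1},\alpha_{n-1})$. $U=U_{r,s}(\mathfrak{so}_{2n})$ is the unital associative $K$-algebra generated by $e_i,f_i,w_i^{\pm1},w_i'^{\pm1}$ $(1\le i\le n)$ with relations: - all $w_i^{\pm1},w_j'^{\pm1}$ commute,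 and $w_iw_i^{-1}=w_i'w_i'^{-1}=1$; - $w_je_i=r^{A_{ji}}s^{B_{ji}}e_iw_j$, $\;w_jf_i=r^{-A_{ji}}s^{-B_{ji}}f_iw_j$, $\;w_j'e_i=s^{A_{ji}}r^{B_{ji}}e_iw_j'$, $\;w_j'f_i=s^{-A_{ji}}r^{-B_{ji}}f_iw_j'$; - $[e_i,f_j]=\delta_{ij}\frac{w_i-w_i'}{r-s}$; - $[e_i,e_j]=[f_i,f_j]=0$ if $i\neq j$, $a_{ij}=0$ and $\{i,j\}\ne\{n-1,n\}$; $\;e_{n-1}e_n=rs\,e_ne_{n-1}$, $\;f_nf_{n-1}=rs\,f_{n-1}f_n$; - for $i<j$ with $a_{ij}=-1$: $e_i^2e_j-(r+s)e_ie_je_i+rs\,e_je_i^2=0$, $\;f_jf_i^2-(r+s)f_if_jf_i+rs\,f_i^2f_j=0$, $\;e_j^2e_i-(r^{-1}+s^{-1})e_je_ie_j+r^{-1}s^{-1}e_ie_j^2=0$, $\;f_if_j^2-(r^{-1}+s^{-1})f_jf_if_j+r^{-1}s^{-1}f_j^2f_i=0$. Its coproduct is $\Delta(e_i)=e_i\otimes1+w_i\otimes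 e_i$, $\Delta(f_i)=1\otimes f_i+f_i\otimes w_i'$, with $w_i,w_i'$ group-like. Put $i'=2n+1-i$. The vector representation $V$ has basis $v_1,\dots,v_{2n}$, and the generators act by (with $E_{kl}v_l=v_k$) $$e_i\mapsto E_{i,i+1}-r^{-1/2}s^{-1/2}E_{(i+1)',i'},\quad f_i\mapsto E_{i+1,i}-r^{-1/2}s^{-1/2}E_{i',(i+1)'}\quad(i<n),$$ $$e_n\mapsto E_{n,n+2}-r^{-1/2}s^{-1/2}E_{(n+2)',n'},\quad f_n\mapsto E_{n+2,n}-r^{-1/2}s^{-1/2}E_{n',(n+2)'}.$$ Each $w_i$ is diagonal. For $i<n$ its eigenvalues on $v_i,v_{i+1},v_{(i+1)'},v_{i'}$ are $r,s,s^{-1},r^{-1}$ and it is $1$ on the other $v_j$; the eigenvalues of $w_n$ on $v_{n-1},v_n,v_{n'},v_{(n-1)'}$ are $s^{-1},r,r^{-1},s$, and it acts as $r^{-1}s^{-1}$ on $v_j$ and as $rs$ on $v_{j'}$ for $j\le n-2$. The action of $w_i'$ is that of $w_i$ with $r$ and $s$ interchanged. $U$ acts on $V\otimes V$ through $\Delta$.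 Define three $U$-submodules of $V\otimes V$: - $S^\circ(V\otimes V)$ is generated by $\omega=\sum_{i=1}^{2n}a_i\,v_{i'}\otimes v_i$, where $a_i=(rs^{-1})^{(n-i)/2}$ for $1\le i\le n$, $a_{n+1}=1$, and $a_i=(rs^{-1})^{(n-i+1)/2}$ for $n+2\le i\le 2n$. - $S'(V\otimes V)$ is generated by $v_i\otimes v_i$ $(1\le i\le 2n)$; $v_i\otimes v_j+s\,v_j\otimes v_i$ for $(i,j)\in P$; $v_i\otimes v_j+r^{-1}v_j\otimes v_i$ for $(i,j)\in P'$; and $v_i\otimes v_{i'}+r^{-1}s\,v_{i'}\otimes v_i-(r^{-1}s)^{1/2}(v_{(i+1)'}\otimes v_{i+1}+v_{i+1}\otimes v_{(i+1)'})$ for $1\le i\le n-1$. - $\Lambda(V\otimes V)$ is generated by $v_i\otimes v_j-r\,v_j\otimes v_i$ for $(i,j)\in P$; $v_i\otimes v_j-s^{-1}v_j\otimes v_i$ for $(i,j)\in P'$; and $-(rs)^{-1/2}v_i\otimes v_{i'}-s^{-1}v_{(i+1)'}\otimes v_{i+1}+r^{-1}v_{i+1}\otimes v_{(i+1)'}+(rs)^{-1/2}v_{i'}\otimes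 v_i$ for $1\le i\le n-1$. Here $P$ is the set of $(i,j)$ with $1\le i\le n$ and either $i+1\le j\le n$ or $i'+1\le j\le 2n$, and $P'$ is the set of $(i,j)$ with either $1\le i\le n-1$, $n+1\le j\le 2n-i$, or $n+1\le i\le 2n-1$, $i+1\le j\le 2n$. Then: 1. As a $U$-module, $V\otimes V=S^\circ(V\otimes V)\oplus S'(V\otimes V)\oplus\Lambda(V\otimes V)$. 2. The three submodules are simple. 3. $S^\circ(V\otimes V)$ is one-dimensional over $K$, spanned by $\omega$; $S'(V\otimes V)$ is the $K$-span of its listed generators; and $\Lambda(V\otimes V)$ is the $K$-span of its listed generators together with $v_n\otimes v_{n'}-v_{n'}\otimes v_n$. 4. $v_1\otimes v_1$ is a highest weight vector of $S'(V\otimes V)$ and $v_1\otimes v_2-r\,v_2\otimes v_1$ is a highest weight vector of $\Lambda(V\otimes V)$: each is a nonzero common eigenvector of all $w_i,w_i'$, is killed by all $e_i$, and generates the submodule. -/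

import Mathlib

open scoped TensorProduct

set_option linter.unusedSectionVars false
set_option linter.unusedVariables false
set_option linter.unusedSimpArgs false

noncomputable section

namespace TwoParamD

/-- A rank `n ≥ 3` and a ground field `K` of characteristic zero with two parameters `r`, `s` that
are algebraically independent over `ℚ`, together with chosen square roots `rh = r^(1/2)` and
`sh = s^(1/2)` of them in `K`; for instance `K = ℚ(r^(1/2), s^(1/2))`. -/
structure Datum (K : Type*) [Field K] [CharZero K] where
  n : ℕ
  three_le : 3 ≤ n
  r : K
  s : K
  rh : K
  sh : K
  rh_sq : rh ^ 2 = r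
  sh_sq : sh ^ 2 = s
  indep : AlgebraicIndependent ℚ ![r, s]

section RootSystem

/-- The integer `(ε_k, α_i)` for the simple roots `α_i = ε_i - ε_{i+1}` (`1 ≤ i < n`) and
`α_n = ε_{n-1} + ε_n` of type `D_n`. All indices are 1-based. -/
def epsAlpha (n k i : ℕ) : ℤ :=
  if i < n then (if k = i then 1 else 0) - (if k = i + 1 then 1 else 0)
  else (if k + 1 = n then 1 else 0) + (if k = n then 1 else 0)

/-- The Cartan matrix entry `a_{ij} = (α_i, α_j)` (all roots have square length two). -/
def cartan (n i j : ℕ) : ℤ :=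
  ∑ k ∈ Finset.Icc 1 n, epsAlpha n k i * epsAlpha n k j

/-- The exponent of `r` in `w_j e_i w_j⁻¹ = r^A s^B e_i`. -/
def expA (n j i : ℕ) : ℤ :=
  if j < n then epsAlpha n j i
  else if i + 1 = n then epsAlpha n n i
  else epsAlpha n (n - 1) i

/-- The exponent of `s` in `w_j e_i w_j⁻¹ = r^A s^B e_i`. -/
def expB (n j i : ℕ) : ℤ :=
  if j < n then epsAlpha n (j + 1) i
  else if i + 1 = n then -epsAlpha n (n - 1) i
  else -epsAlpha n n i

end RootSystem

/-- The 1-based index attached to `i : Fin n`. -/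
abbrev ix {n : ℕ} (i : Fin n) : ℕ := (i : ℕ) + 1

/-- The torus generators `w_i`, `w_i⁻¹`, `w'_i`, `w'_i⁻¹`. -/
inductive Tor (n : ℕ)
  | w (i : Fin n)
  | wInv (i : Fin n)
  | w' (i : Fin n)
  | w'Inv (i : Fin n)

/-- The generators of the two-parameter quantum group. -/
inductive Gen (n : ℕ)
  | e (i : Fin n)
  | f (i : Fin n)
  | t (a : Tor n)

variable {K : Type*} [Field K] [CharZero K] (D : Datum K)

namespace Free

/-- The free algebra on the generators. -/
abbrev A := FreeAlgebra K (Gen D.n)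

def e (i : Fin D.n) : A D := FreeAlgebra.ι K (Gen.e i)
def f (i : Fin D.n) : A D := FreeAlgebra.ι K (Gen.f i)
def t (a : Tor D.n) : A D := FreeAlgebra.ι K (Gen.t a)
def w (i : Fin D.n) : A D := t D (Tor.w i)
def wInv (i : Fin D.n) : A D := t D (Tor.wInv i)
def w' (i : Fin D.n) : A D := t D (Tor.w' i)
def w'Inv (i : Fin D.n) : A D := t D (Tor.w'Inv i)

end Free

open Free in
/-- The defining relations of `U_{r,s}(so_{2n})`. -/
inductive Rel : Free.A D → Free.A D → Prop
  | torus_comm (a b : Tor D.n) : Rel (t D a * t D b) (t D b * t D a)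
  | w_inv (i : Fin D.n) : Rel (w D i * wInv D i) 1
  | w'_inv (i : Fin D.n) : Rel (w' D i * w'Inv D i) 1
  | w_e (j i : Fin D.n) : Rel (w D j * e D i)
      ((D.r ^ expA D.n (ix j) (ix i) * D.s ^ expB D.n (ix j) (ix i)) • (e D i * w D j))
  | w_f (j i : Fin D.n) : Rel (w D j * f D i)
      ((D.r ^ (-expA D.n (ix j) (ix i)) * D.s ^ (-expB D.n (ix j) (ix i))) • (f D i * w D j))
  | w'_e (j i : Fin D.n) : Rel (w' D j * e D i)
      ((D.s ^ expA D.n (ix j) (ix i) * D.r ^ expB D.n (ix j) (ix i)) • (e D i * w' D j))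
  | w'_f (j i : Fin D.n) : Rel (w' D j * f D i)
      ((D.s ^ (-expA D.n (ix j) (ix i)) * D.r ^ (-expB D.n (ix j) (ix i))) • (f D i * w' D j))
  | e_f (i : Fin D.n) : Rel (e D i * f D i - f D i * e D i) ((D.r - D.s)⁻¹ • (w D i - w' D i))
  | e_f_ne (i j : Fin D.n) : i ≠ j → Rel (e D i * f D j - f D j * e D i) 0
  | e_comm (i j : Fin D.n) : i ≠ j → cartan D.n (ix i) (ix j) = 0 →
      ¬(ix i + 1 = D.n ∧ ix j = D.n) → ¬(ix i = D.n ∧ ix j + 1 = D.n) →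
      Rel (e D i * e D j) (e D j * e D i)
  | f_comm (i j : Fin D.n) : i ≠ j → cartan D.n (ix i) (ix j) = 0 →
      ¬(ix i + 1 = D.n ∧ ix j = D.n) → ¬(ix i = D.n ∧ ix j + 1 = D.n) →
      Rel (f D i * f D j) (f D j * f D i)
  | e_last (i j : Fin D.n) : ix i + 1 = D.n → ix j = D.n →
      Rel (e D i * e D j) ((D.r * D.s) • (e D j * e D i))
  | f_last (i j : Fin D.n) : ix i + 1 = D.n → ix j = D.n →
      Rel (f D j * f D i) ((D.r * D.s) • (f D i * f D j))
  | serre_e (i j : Fin D.n) : i < j → cartan D.n (ix i) (ix j) = -1 →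
      Rel (e D i ^ 2 * e D j - (D.r + D.s) • (e D i * e D j * e D i)
        + (D.r * D.s) • (e D j * e D i ^ 2)) 0
  | serre_f (i j : Fin D.n) : i < j → cartan D.n (ix i) (ix j) = -1 →
      Rel (f D j * f D i ^ 2 - (D.r + D.s) • (f D i * f D j * f D i)
        + (D.r * D.s) • (f D i ^ 2 * f D j)) 0
  | serre_e' (i j : Fin D.n) : i < j → cartan D.n (ix i) (ix j) = -1 →
      Rel (e D j ^ 2 * e D i - (D.r⁻¹ + D.s⁻¹) • (e D j * e D i * e D j)
        + (D.r⁻¹ * D.s⁻¹) • (e D i * e D j ^ 2)) 0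
  | serre_f' (i j : Fin D.n) : i < j → cartan D.n (ix i) (ix j) = -1 →
      Rel (f D i * f D j ^ 2 - (D.r⁻¹ + D.s⁻¹) • (f D j * f D i * f D j)
        + (D.r⁻¹ * D.s⁻¹) • (f D j ^ 2 * f D i)) 0

/-- The two-parameter quantum group `U_{r,s}(so_{2n})`. -/
abbrev U := RingQuot (Rel D)

namespace U

/-- The class in `U` of an element of the free algebra. -/
def mk : Free.A D →ₐ[K] U D := RingQuot.mkAlgHom K (Rel D)

def e (i : Fin D.n) : U D := mk D (Free.e D i)
def f (i : Fin D.n) : U D := mk D (Free.f D i)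
def t (a : Tor D.n) : U D := mk D (Free.t D a)
def w (i : Fin D.n) : U D := mk D (Free.w D i)
def w' (i : Fin D.n) : U D := mk D (Free.w' D i)

end U

section Parameters

theorem r_ne_zero : D.r ≠ 0 := by
  have := D.indep.ne_zero 0
  simpa using this

theorem s_ne_zero : D.s ≠ 0 := by
  have := D.indep.ne_zero 1
  simpa using this

theorem r_ne_s : D.r ≠ D.s := by
  intro h
  have := D.indep.injective (a₁ := 0) (a₂ := 1) (by simpa using h)
  simp at this

theorem rh_ne_zero : D.rh ≠ 0 := by
  intro h
  apply r_ne_zero D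
  rw [← D.rh_sq, h]; simp

theorem sh_ne_zero : D.sh ≠ 0 := by
  intro h
  apply s_ne_zero D
  rw [← D.sh_sq, h]; simp

end Parameters

section Coproduct

open U TensorProduct

/-- The coproduct on generators: `Δ(e_i) = e_i ⊗ 1 + w_i ⊗ e_i`, `Δ(f_i) = 1 ⊗ f_i + f_i ⊗ w'_i`,
and the torus generators are group-like. -/
def comulGen : Gen D.n → U D ⊗[K] U D
  | .e i => e D i ⊗ₜ 1 + w D i ⊗ₜ e D i
  | .f i => 1 ⊗ₜ f D i + f D i ⊗ₜ w' D i
  | .t a => t D a ⊗ₜ t D a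

end Coproduct

section VectorRepresentation

/-- The underlying space of the vector representation, with its standard basis. -/
abbrev Vec := Fin (2 * D.n) → K

/-- The basis vector `v_j`, `1 ≤ j ≤ 2n` (and zero for other `j`). -/
def v (j : ℕ) : Vec D := fun k => if (k : ℕ) + 1 = j then 1 else 0

/-- The matrix unit `E_{kl}`, `1 ≤ k, l ≤ 2n`. -/
def E (k l : ℕ) : Matrix (Fin (2 * D.n)) (Fin (2 * D.n)) K :=
  Matrix.of fun a b => if (a : ℕ) + 1 = k ∧ (b : ℕ) + 1 = l then 1 else 0

/-- `j' = 2n + 1 - j`. -/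
abbrev pr (j : ℕ) : ℕ := 2 * D.n + 1 - j

/-- The diagonal entries of `T(w_i)`; those of `T(w'_i)` arise by taking `(s, r)` in place
of `(r, s)`. All indices are 1-based. -/
def diagEntry (n : ℕ) (r s : K) (i j : ℕ) : K :=
  if i < n then
    if j = i then r else if j = i + 1 then s
    else if j = 2 * n + 1 - (i + 1) then s⁻¹ else if j = 2 * n + 1 - i then r⁻¹ else 1
  else
    if j + 1 = n then s⁻¹ else if j = n then r
    else if j = n + 1 then r⁻¹ else if j = n + 2 then s
    else if j + 2 ≤ n then r⁻¹ * s⁻¹ else r * s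

def diagMat (r s : K) (i : ℕ) : Matrix (Fin (2 * D.n)) (Fin (2 * D.n)) K :=
  Matrix.diagonal fun a => diagEntry D.n r s i ((a : ℕ) + 1)

def diagMatInv (r s : K) (i : ℕ) : Matrix (Fin (2 * D.n)) (Fin (2 * D.n)) K :=
  Matrix.diagonal fun a => (diagEntry D.n r s i ((a : ℕ) + 1))⁻¹

/-- The matrices of the generators in the vector representation. -/
def vecGen : Gen D.n → Matrix (Fin (2 * D.n)) (Fin (2 * D.n)) K
  | .e i =>
      if ix i < D.n then
        E D (ix i) (ix i + 1) - (D.rh⁻¹ * D.sh⁻¹) • E D (pr D (ix i + 1)) (pr D (ix i))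
      else E D D.n (D.n + 2) - (D.rh⁻¹ * D.sh⁻¹) • E D (pr D (D.n + 2)) (pr D D.n)
  | .f i =>
      if ix i < D.n then
        E D (ix i + 1) (ix i) - (D.rh⁻¹ * D.sh⁻¹) • E D (pr D (ix i)) (pr D (ix i + 1))
      else E D (D.n + 2) D.n - (D.rh⁻¹ * D.sh⁻¹) • E D (pr D D.n) (pr D (D.n + 2))
  | .t (.w i) => diagMat D D.r D.s (ix i)
  | .t (.wInv i) => diagMatInv D D.r D.s (ix i)
  | .t (.w' i) => diagMat D D.s D.r (ix i)
  | .t (.w'Inv i) => diagMatInv D D.s D.r (ix i)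

end VectorRepresentation
section VecProof

theorem E_mul (k l a b : ℕ) :
    E D k l * E D a b = if l = a ∧ 1 ≤ l ∧ l ≤ 2 * D.n then E D k b else 0 := by
  ext x y
  rw [Matrix.mul_apply]
  split_ifs with h
  · obtain ⟨rfl, h1, h2⟩ := h
    rw [Finset.sum_eq_single (⟨l - 1, by omega⟩ : Fin (2 * D.n))]
    · simp only [E, Matrix.of_apply]
      grind
    · intro c _ hc
      have : (c : ℕ) + 1 ≠ l := fun h => hc (Fin.ext (by simp; omega))
      simp [E, this]
    · simp
  · apply Finset.sum_eq_zero
    intro c _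
    have := c.2
    simp only [E, Matrix.of_apply]
    grind

theorem diag_mul_E (g : ℕ → K) (k l : ℕ) :
    (Matrix.diagonal fun a : Fin (2 * D.n) => g ((a : ℕ) + 1)) * E D k l = g k • E D k l := by
  ext x y
  simp only [Matrix.diagonal_mul, E, Matrix.of_apply, Matrix.smul_apply, smul_eq_mul]
  grind

theorem E_mul_diag (g : ℕ → K) (k l : ℕ) :
    E D k l * (Matrix.diagonal fun a : Fin (2 * D.n) => g ((a : ℕ) + 1)) = g l • E D k l := by
  ext x y
  simp only [Matrix.mul_diagonal, E, Matrix.of_apply, Matrix.smul_apply, smul_eq_mul]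
  grind

/-- Exponent of `r` in `diagEntry`. -/
def wtA (n i j : ℕ) : ℤ :=
  if i < n then (if j = i then 1 else if j = 2 * n + 1 - i then -1 else 0)
  else if j + 1 = n then 0 else if j = n then 1 else if j = n + 1 then -1
    else if j = n + 2 then 0 else if j + 2 ≤ n then -1 else 1

/-- Exponent of `s` in `diagEntry`. -/
def wtB (n i j : ℕ) : ℤ :=
  if i < n then (if j = i + 1 then 1 else if j = 2 * n + 1 - (i + 1) then -1 else 0)
  else if j + 1 = n then -1 else if j = n then 0 else if j = n + 1 then 0
    else if j = n + 2 then 1 else if j + 2 ≤ n then -1 else 1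

theorem diagEntry_eq (n : ℕ) (r s : K) (i j : ℕ) :
    diagEntry n r s i j = r ^ wtA n i j * s ^ wtB n i j := by
  unfold diagEntry wtA wtB
  split_ifs <;> first | omega | simp

theorem diagEntry_ne_zero (n : ℕ) {r s : K} (hr : r ≠ 0) (hs : s ≠ 0) (i j : ℕ) :
    diagEntry n r s i j ≠ 0 := by
  rw [diagEntry_eq]; positivity

/-- Row index of the leading matrix unit of `T(e_i)`. -/
def ra (n i : ℕ) : ℕ := if i < n then i else n
/-- Column index of the leading matrix unit of `T(e_i)`. -/
def rb (n i : ℕ) : ℕ := if i < n then i + 1 else n + 2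

theorem vecGen_e (i : Fin D.n) : vecGen D (.e i) =
    E D (ra D.n (ix i)) (rb D.n (ix i))
      - (D.rh⁻¹ * D.sh⁻¹) • E D (pr D (rb D.n (ix i))) (pr D (ra D.n (ix i))) := by
  simp only [vecGen, ra, rb]; split_ifs <;> rfl

theorem vecGen_f (i : Fin D.n) : vecGen D (.f i) =
    E D (rb D.n (ix i)) (ra D.n (ix i))
      - (D.rh⁻¹ * D.sh⁻¹) • E D (pr D (ra D.n (ix i))) (pr D (rb D.n (ix i))) := by
  simp only [vecGen, ra, rb]; split_ifs <;> rfl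

theorem wtA_diff (n : ℕ) (hn : 3 ≤ n) (j i : ℕ) (hj : 1 ≤ j) (hj' : j ≤ n) (hi : 1 ≤ i)
    (hi' : i ≤ n) : wtA n j (ra n i) = expA n j i + wtA n j (rb n i) := by
  unfold wtA expA epsAlpha ra rb
  by_cases h1 : j < n <;> by_cases h2 : i < n <;> simp only [h1, h2, if_true, if_false]
  all_goals grind

theorem wtB_diff (n : ℕ) (hn : 3 ≤ n) (j i : ℕ) (hj : 1 ≤ j) (hj' : j ≤ n) (hi : 1 ≤ i)
    (hi' : i ≤ n) : wtB n j (ra n i) = expB n j i + wtB n j (rb n i) := by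
  unfold wtB expB epsAlpha ra rb
  by_cases h1 : j < n <;> by_cases h2 : i < n <;> simp only [h1, h2, if_true, if_false]
  all_goals grind

theorem wtA_pr (n : ℕ) (hn : 3 ≤ n) (j x : ℕ) (hj : 1 ≤ j) (hj' : j ≤ n) (hx : 1 ≤ x)
    (hx' : x ≤ 2 * n) : wtA n j (2 * n + 1 - x) = - wtA n j x := by
  unfold wtA
  by_cases h1 : j < n <;> simp only [h1, if_true, if_false]
  all_goals split_ifs <;> omega

theorem wtB_pr (n : ℕ) (hn : 3 ≤ n) (j x : ℕ) (hj : 1 ≤ j) (hj' : j ≤ n) (hx : 1 ≤ x)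
    (hx' : x ≤ 2 * n) : wtB n j (2 * n + 1 - x) = - wtB n j x := by
  unfold wtB
  by_cases h1 : j < n <;> simp only [h1, if_true, if_false]
  all_goals split_ifs <;> omega

theorem ra_mem (n : ℕ) (hn : 3 ≤ n) (i : ℕ) (hi : 1 ≤ i) (hi' : i ≤ n) :
    1 ≤ ra n i ∧ ra n i ≤ 2 * n ∧ 1 ≤ rb n i ∧ rb n i ≤ 2 * n := by
  unfold ra rb; split_ifs <;> omega

theorem diag_e (n : ℕ) (hn : 3 ≤ n) {r s : K} (hr : r ≠ 0) (hs : s ≠ 0) (j i : ℕ)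
    (hj : 1 ≤ j) (hj' : j ≤ n) (hi : 1 ≤ i) (hi' : i ≤ n) :
    diagEntry n r s j (ra n i) = r ^ expA n j i * s ^ expB n j i * diagEntry n r s j (rb n i) := by
  rw [diagEntry_eq, diagEntry_eq, wtA_diff n hn j i hj hj' hi hi',
    wtB_diff n hn j i hj hj' hi hi', zpow_add₀ hr, zpow_add₀ hs]
  ring

theorem diag_pr (n : ℕ) (hn : 3 ≤ n) {r s : K} (j x : ℕ)
    (hj : 1 ≤ j) (hj' : j ≤ n) (hx : 1 ≤ x) (hx' : x ≤ 2 * n) :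
    diagEntry n r s j (2 * n + 1 - x) = (diagEntry n r s j x)⁻¹ := by
  rw [diagEntry_eq, diagEntry_eq, wtA_pr n hn j x hj hj' hx hx',
    wtB_pr n hn j x hj hj' hx hx']
  simp only [zpow_neg, mul_inv]

theorem diagMat_e {r s : K} (hr : r ≠ 0) (hs : s ≠ 0) (j i : Fin D.n) :
    diagMat D r s (ix j) * vecGen D (.e i) =
      (r ^ expA D.n (ix j) (ix i) * s ^ expB D.n (ix j) (ix i)) •
        (vecGen D (.e i) * diagMat D r s (ix j)) := by
  have hn := D.three_le
  have hi : 1 ≤ ix i ∧ ix i ≤ D.n := by have := i.2; simp only [ix]; omega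
  have hj : 1 ≤ ix j ∧ ix j ≤ D.n := by have := j.2; simp only [ix]; omega
  obtain ⟨m1, m2, m3, m4⟩ := ra_mem D.n hn _ hi.1 hi.2
  have h := diag_e D.n hn hr hs _ _ hj.1 hj.2 hi.1 hi.2
  have p1 := diag_pr D.n hn (r := r) (s := s) _ _ hj.1 hj.2 m1 m2
  have p2 := diag_pr D.n hn (r := r) (s := s) _ _ hj.1 hj.2 m3 m4
  have z := diagEntry_ne_zero D.n hr hs (ix j) (rb D.n (ix i))
  rw [vecGen_e, diagMat, mul_sub, sub_mul, mul_smul_comm, smul_mul_assoc, diag_mul_E, diag_mul_E,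
    E_mul_diag, E_mul_diag, smul_sub, smul_smul, smul_smul, smul_smul, smul_smul, p1, p2, h]
  congr 1
  congr 1
  have h1 : r ^ expA D.n (ix j) (ix i) ≠ 0 := zpow_ne_zero _ hr
  have h2 : s ^ expB D.n (ix j) (ix i) ≠ 0 := zpow_ne_zero _ hs
  field_simp

theorem diagMat_f {r s : K} (hr : r ≠ 0) (hs : s ≠ 0) (j i : Fin D.n) :
    diagMat D r s (ix j) * vecGen D (.f i) =
      (r ^ (-expA D.n (ix j) (ix i)) * s ^ (-expB D.n (ix j) (ix i))) •
        (vecGen D (.f i) * diagMat D r s (ix j)) := by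
  have hn := D.three_le
  have hi : 1 ≤ ix i ∧ ix i ≤ D.n := by have := i.2; simp only [ix]; omega
  have hj : 1 ≤ ix j ∧ ix j ≤ D.n := by have := j.2; simp only [ix]; omega
  obtain ⟨m1, m2, m3, m4⟩ := ra_mem D.n hn _ hi.1 hi.2
  have h := diag_e D.n hn hr hs _ _ hj.1 hj.2 hi.1 hi.2
  have p1 := diag_pr D.n hn (r := r) (s := s) _ _ hj.1 hj.2 m1 m2
  have p2 := diag_pr D.n hn (r := r) (s := s) _ _ hj.1 hj.2 m3 m4
  have z := diagEntry_ne_zero D.n hr hs (ix j) (rb D.n (ix i))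
  have h1 : r ^ expA D.n (ix j) (ix i) ≠ 0 := zpow_ne_zero _ hr
  have h2 : s ^ expB D.n (ix j) (ix i) ≠ 0 := zpow_ne_zero _ hs
  rw [vecGen_f, diagMat, mul_sub, sub_mul, mul_smul_comm, smul_mul_assoc, diag_mul_E, diag_mul_E,
    E_mul_diag, E_mul_diag, smul_sub, smul_smul, smul_smul, smul_smul, smul_smul, p1, p2, h,
    zpow_neg, zpow_neg]
  congr 1
  · congr 1
    field_simp
  · congr 1
    field_simp

theorem diagMat_mul_inv {r s : K} (hr : r ≠ 0) (hs : s ≠ 0) (j : ℕ) :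
    diagMat D r s j * diagMatInv D r s j = 1 := by
  simp only [diagMat, diagMatInv, Matrix.diagonal_mul_diagonal]
  rw [← Matrix.diagonal_one]
  congr 1
  funext a
  exact mul_inv_cancel₀ (diagEntry_ne_zero D.n hr hs _ _)

theorem tor_diag (a : Tor D.n) : ∃ d, vecGen D (.t a) = Matrix.diagonal d := by
  cases a <;> exact ⟨_, rfl⟩

theorem cartan_eq (n : ℕ) (hn : 3 ≤ n) (i j : ℕ) (hi : 1 ≤ i) (hij : i < j) (hj : j ≤ n) :
    cartan n i j =
      if j < n then (if i + 1 = j then -1 else 0) else (if i + 2 = n then -1 else 0) := by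
  have key : ∀ (g : ℕ → ℤ), ∑ k ∈ Finset.Icc 1 n, epsAlpha n k i * g k = g i - g (i + 1) := by
    intro g
    have hi1 : i < n := by omega
    have : ∀ k ∈ Finset.Icc 1 n, epsAlpha n k i * g k
        = (if k = i then g k else 0) - (if k = i + 1 then g k else 0) := by
      intro k _
      simp only [epsAlpha, hi1, if_true, sub_mul, ite_mul, one_mul, zero_mul]
    rw [Finset.sum_congr rfl this, Finset.sum_sub_distrib, Finset.sum_ite_eq', Finset.sum_ite_eq']
    rw [if_pos (by simp; omega), if_pos (by simp; omega)]
  rw [cartan, key]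
  unfold epsAlpha
  split_ifs <;> omega

theorem ef_diag (n : ℕ) (hn : 3 ≤ n) (i x : ℕ) (hi : 1 ≤ i) (hi' : i ≤ n) (hx : 1 ≤ x)
    (hx' : x ≤ 2 * n) {r s : K} (hr : r ≠ 0) (hs : s ≠ 0) (hrs : r ≠ s) :
    (r - s)⁻¹ * (diagEntry n r s i x - diagEntry n s r i x) =
      (if x = ra n i then 1 else 0) - (if x = rb n i then 1 else 0)
      + (r⁻¹ * s⁻¹) * ((if x = 2 * n + 1 - rb n i then 1 else 0)
        - (if x = 2 * n + 1 - ra n i then 1 else 0)) := by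
  have h : r - s ≠ 0 := sub_ne_zero.mpr hrs
  unfold diagEntry ra rb
  by_cases h1 : i < n <;> simp only [h1, if_true, if_false]
  all_goals split_ifs <;> first | omega | (field_simp; ring)

theorem ef_same (i : Fin D.n) :
    vecGen D (.e i) * vecGen D (.f i) - vecGen D (.f i) * vecGen D (.e i) =
      (D.r - D.s)⁻¹ • (diagMat D D.r D.s (ix i) - diagMat D D.s D.r (ix i)) := by
  have hn := D.three_le
  have hi : 1 ≤ ix i ∧ ix i ≤ D.n := by have := i.2; simp only [ix]; omega
  obtain ⟨m1, m2, m3, m4⟩ := ra_mem D.n hn _ hi.1 hi.2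
  have e1 : ra D.n (ix i) ≠ pr D (rb D.n (ix i)) := by
    unfold ra rb; simp only [pr]; split_ifs <;> omega
  have e2 : rb D.n (ix i) ≠ pr D (ra D.n (ix i)) := by
    unfold ra rb; simp only [pr]; split_ifs <;> omega
  have b1 : 1 ≤ pr D (ra D.n (ix i)) ∧ pr D (ra D.n (ix i)) ≤ 2 * D.n := by
    simp only [pr]; omega
  have b2 : 1 ≤ pr D (rb D.n (ix i)) ∧ pr D (rb D.n (ix i)) ≤ 2 * D.n := by
    simp only [pr]; omega
  rw [vecGen_e, vecGen_f]
  simp only [mul_sub, sub_mul, mul_smul_comm, smul_mul_assoc, E_mul, e1, e2, e1.symm, e2.symm,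
    m1, m2, m3, m4, b1, b2, and_self, if_true, false_and, if_false, smul_zero, sub_zero, zero_sub,
    true_and]
  ext x y
  have hc : D.rh⁻¹ * D.sh⁻¹ * (D.rh⁻¹ * D.sh⁻¹) = D.r⁻¹ * D.s⁻¹ := by
    rw [← D.rh_sq, ← D.sh_sq]; ring
  by_cases hxy : x = y
  · subst hxy
    have := ef_diag D.n hn (ix i) (x + 1) hi.1 hi.2 (by omega) (by have := x.2; omega)
      (r_ne_zero D) (s_ne_zero D) (r_ne_s D)
    simp only [Matrix.smul_apply, Matrix.sub_apply, Matrix.neg_apply, diagMat,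
      Matrix.diagonal_apply_eq, smul_eq_mul, this, E, Matrix.of_apply, and_self, ← hc]
    ring
  · have hne : (x : ℕ) ≠ y := fun h => hxy (Fin.ext h)
    simp only [Matrix.smul_apply, Matrix.sub_apply, Matrix.neg_apply, diagMat,
      Matrix.diagonal_apply_ne _ hxy, smul_eq_mul, E, Matrix.of_apply]
    grind

/-- The matrices `T(e_i)` and `T(f_i)` all have this shape. -/
def X (a b : ℕ) : Matrix (Fin (2 * D.n)) (Fin (2 * D.n)) K :=
  E D a b - (D.rh⁻¹ * D.sh⁻¹) • E D (pr D b) (pr D a)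

theorem X_mul_zero (a b c d : ℕ) (h1 : b ≠ c) (h2 : b ≠ pr D d) (h3 : pr D a ≠ c)
    (h4 : pr D a ≠ pr D d) : X D a b * X D c d = 0 := by
  simp only [X, mul_sub, sub_mul, mul_smul_comm, smul_mul_assoc, E_mul, h1, h2, h3, h4,
    false_and, if_false, smul_zero, sub_zero]

theorem E_mul_zero (k l a b : ℕ) (h : l ≠ a) : E D k l * E D a b = 0 := by
  rw [E_mul, if_neg (fun h' => h h'.1)]

theorem E_triple_zero (k l a b c d : ℕ) (h : ¬(l = a ∧ b = c)) :
    E D k l * E D a b * E D c d = 0 := by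
  by_cases h1 : l = a
  · rw [mul_assoc, E_mul_zero D a b c d (fun h2 => h ⟨h1, h2⟩), mul_zero]
  · rw [E_mul_zero D k l a b h1, zero_mul]

theorem X_triple_zero (a b c d : ℕ) (h1 : ¬(b = c ∧ d = a)) (h2 : ¬(b = c ∧ d = pr D b))
    (h3 : ¬(b = pr D d ∧ pr D c = a)) (h4 : ¬(b = pr D d ∧ pr D c = pr D b))
    (h5 : ¬(pr D a = c ∧ d = a)) (h6 : ¬(pr D a = c ∧ d = pr D b))
    (h7 : ¬(pr D a = pr D d ∧ pr D c = a)) (h8 : ¬(pr D a = pr D d ∧ pr D c = pr D b)) :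
    X D a b * X D c d * X D a b = 0 := by
  simp only [X, mul_sub, sub_mul, mul_smul_comm, smul_mul_assoc, E_triple_zero D _ _ _ _ _ _ h1,
    E_triple_zero D _ _ _ _ _ _ h2, E_triple_zero D _ _ _ _ _ _ h3,
    E_triple_zero D _ _ _ _ _ _ h4, E_triple_zero D _ _ _ _ _ _ h5,
    E_triple_zero D _ _ _ _ _ _ h6, E_triple_zero D _ _ _ _ _ _ h7,
    E_triple_zero D _ _ _ _ _ _ h8, smul_zero, sub_zero]

theorem cartan_symm (n i j : ℕ) : cartan n i j = cartan n j i := by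
  unfold cartan
  exact Finset.sum_congr rfl fun k _ => mul_comm _ _

theorem ix_mem {n : ℕ} (i : Fin n) : 1 ≤ ix i ∧ ix i ≤ n := by
  have := i.2; simp only [ix]; omega

theorem X_comm_zero (n i j : ℕ) (hn : n = D.n) (hi : 1 ≤ i ∧ i ≤ n) (hj : 1 ≤ j ∧ j ≤ n)
    (hij : i < j) (hc : cartan n i j = 0) (hl : ¬(i + 1 = n ∧ j = n)) :
    X D (ra n i) (rb n i) * X D (ra n j) (rb n j) = 0 ∧
    X D (ra n j) (rb n j) * X D (ra n i) (rb n i) = 0 ∧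
    X D (rb n i) (ra n i) * X D (rb n j) (ra n j) = 0 ∧
    X D (rb n j) (ra n j) * X D (rb n i) (ra n i) = 0 := by
  have h3 : 3 ≤ n := hn ▸ D.three_le
  rw [cartan_eq n h3 i j hi.1 hij hj.2] at hc
  have hin : i < n := by omega
  by_cases hjn : j < n
  · rw [if_pos hjn] at hc
    have : i + 1 ≠ j := by intro h; simp [h] at hc
    simp only [ra, rb, hin, hjn, if_true]
    refine ⟨?_, ?_, ?_, ?_⟩ <;> apply X_mul_zero <;> (try simp only [pr]) <;> omega
  · rw [if_neg hjn] at hc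
    have : i + 2 ≠ n := by intro h; simp [h] at hc
    simp only [ra, rb, hin, hjn, if_true, if_false]
    refine ⟨?_, ?_, ?_, ?_⟩ <;> apply X_mul_zero <;> (try simp only [pr]) <;> omega

theorem X_serre_zero (n i j : ℕ) (hn : n = D.n) (hi : 1 ≤ i ∧ i ≤ n) (hj : 1 ≤ j ∧ j ≤ n)
    (hij : i < j) (hc : cartan n i j = -1) :
    X D (ra n i) (rb n i) * X D (ra n j) (rb n j) * X D (ra n i) (rb n i) = 0 ∧
    X D (ra n j) (rb n j) * X D (ra n i) (rb n i) * X D (ra n j) (rb n j) = 0 ∧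
    X D (rb n i) (ra n i) * X D (rb n j) (ra n j) * X D (rb n i) (ra n i) = 0 ∧
    X D (rb n j) (ra n j) * X D (rb n i) (ra n i) * X D (rb n j) (ra n j) = 0 := by
  have h3 : 3 ≤ n := hn ▸ D.three_le
  rw [cartan_eq n h3 i j hi.1 hij hj.2] at hc
  have hin : i < n := by omega
  by_cases hjn : j < n
  · rw [if_pos hjn] at hc
    have : i + 1 = j := by by_contra h; simp [h] at hc
    simp only [ra, rb, hin, hjn, if_true]
    refine ⟨?_, ?_, ?_, ?_⟩ <;> apply X_triple_zero <;> (try simp only [pr]) <;> omega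
  · rw [if_neg hjn] at hc
    have : i + 2 = n := by by_contra h; simp [h] at hc
    simp only [ra, rb, hin, hjn, if_true, if_false]
    refine ⟨?_, ?_, ?_, ?_⟩ <;> apply X_triple_zero <;> (try simp only [pr]) <;> omega

theorem X_sq_zero (n i : ℕ) (hn : n = D.n) (hi : 1 ≤ i ∧ i ≤ n) :
    X D (ra n i) (rb n i) ^ 2 = 0 ∧ X D (rb n i) (ra n i) ^ 2 = 0 := by
  have h3 : 3 ≤ n := hn ▸ D.three_le
  rw [pow_two, pow_two]
  by_cases hin : i < n
  · simp only [ra, rb, hin, if_true]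
    refine ⟨?_, ?_⟩ <;> apply X_mul_zero <;> (try simp only [pr]) <;> omega
  · simp only [ra, rb, hin, if_false]
    refine ⟨?_, ?_⟩ <;> apply X_mul_zero <;> (try simp only [pr]) <;> omega

theorem ef_ne (i j : Fin D.n) (hij : i ≠ j) :
    vecGen D (.e i) * vecGen D (.f j) - vecGen D (.f j) * vecGen D (.e i) = 0 := by
  have hn := D.three_le
  have hi := ix_mem i
  have hj := ix_mem j
  have hne : ix i ≠ ix j := fun h => hij (Fin.ext (by simpa [ix] using h))
  rw [vecGen_e, vecGen_f]
  change X D _ _ * X D _ _ - X D _ _ * X D _ _ = 0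
  generalize ix i = i' at *
  generalize ix j = j' at *
  by_cases h1 : i' < D.n <;> by_cases h2 : j' < D.n <;>
    simp only [ra, rb, h1, h2, if_true, if_false]
  · rw [X_mul_zero, X_mul_zero, sub_zero] <;> (try simp only [pr]) <;> omega
  · by_cases h3 : i' + 1 = D.n
    · simp only [X, mul_sub, sub_mul, mul_smul_comm, smul_mul_assoc, E_mul]
      have e1 : pr D (i' + 1) = D.n + 1 := by simp only [pr]; omega
      have e2 : pr D i' = D.n + 2 := by simp only [pr]; omega
      have e3 : pr D D.n = D.n + 1 := by simp only [pr]; omega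
      have e4 : pr D (D.n + 2) = i' := by simp only [pr]; omega
      simp only [e1, e2, e3, e4, h3]
      grind
    · rw [X_mul_zero, X_mul_zero, sub_zero] <;> (try simp only [pr]) <;> omega
  · by_cases h3 : j' + 1 = D.n
    · simp only [X, mul_sub, sub_mul, mul_smul_comm, smul_mul_assoc, E_mul]
      have e1 : pr D (j' + 1) = D.n + 1 := by simp only [pr]; omega
      have e2 : pr D j' = D.n + 2 := by simp only [pr]; omega
      have e3 : pr D D.n = D.n + 1 := by simp only [pr]; omega
      have e4 : pr D (D.n + 2) = j' := by simp only [pr]; omega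
      simp only [e1, e2, e3, e4, h3]
      grind
    · rw [X_mul_zero, X_mul_zero, sub_zero] <;> (try simp only [pr]) <;> omega
  · omega

theorem last_rel (n i j : ℕ) (hn : n = D.n) (hi : i + 1 = n) (hj : j = n) :
    X D (ra n i) (rb n i) * X D (ra n j) (rb n j) =
      (D.r * D.s) • (X D (ra n j) (rb n j) * X D (ra n i) (rb n i)) ∧
    X D (rb n j) (ra n j) * X D (rb n i) (ra n i) =
      (D.r * D.s) • (X D (rb n i) (ra n i) * X D (rb n j) (ra n j)) := by
  have h3 : 3 ≤ n := hn ▸ D.three_le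
  have hin : i < n := by omega
  have hjn : ¬ j < n := by omega
  have hc : D.r * D.s * (D.rh⁻¹ * D.sh⁻¹ * (D.rh⁻¹ * D.sh⁻¹)) = 1 := by
    have := rh_ne_zero D
    have := sh_ne_zero D
    rw [← D.rh_sq, ← D.sh_sq]; field_simp
  simp only [ra, rb, hin, hjn, if_true, if_false, X]
  have e1 : pr D (i + 1) = D.n + 1 := by simp only [pr]; omega
  have e2 : pr D i = D.n + 2 := by simp only [pr]; omega
  have e3 : pr D n = D.n + 1 := by simp only [pr]; omega
  have e4 : pr D (n + 2) = i := by simp only [pr]; omega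
  simp only [mul_sub, sub_mul, mul_smul_comm, smul_mul_assoc, E_mul, e1, e2, e3, e4]
  have f1 : i + 1 = n := hi
  subst hn
  simp only [f1]
  have g1 : ¬ (D.n = i) := by omega
  have g2 : ¬ (i = D.n) := by omega
  have g3 : 1 ≤ D.n ∧ D.n ≤ 2 * D.n := by omega
  have g4 : 1 ≤ D.n + 1 ∧ D.n + 1 ≤ 2 * D.n := by omega
  have g5 : ¬ (D.n + 2 = D.n) := by omega
  have g6 : ¬ (D.n + 2 = i) := by omega
  have g7 : ¬ (D.n = D.n + 2) := by omega
  have g8 : ¬ (i = D.n + 2) := by omega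
  have g9 : ¬ (i = D.n + 1) := by omega
  have g10 : ¬ (D.n + 1 = i) := by omega
  simp only [g1, g2, g3, g4, g5, g6, g7, g8, g9, g10, true_and, false_and, if_true, if_false,
    smul_zero, sub_zero, zero_sub, smul_sub, smul_neg, smul_smul, hc, one_smul, and_self,
    add_right_inj, left_eq_add, add_eq_left, one_ne_zero, OfNat.ofNat_ne_zero, OfNat.one_ne_ofNat,
    OfNat.ofNat_ne_one, sub_neg_eq_add, neg_neg, zero_add, neg_zero, sub_self]

/-- The matrices of the vector representation satisfy the defining relations. -/
theorem vecGen_rel {x y : Free.A D} (h : Rel D x y) :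
    FreeAlgebra.lift K (vecGen D) x = FreeAlgebra.lift K (vecGen D) y := by
  have hr := r_ne_zero D
  have hs := s_ne_zero D
  have xe : ∀ i, vecGen D (.e i) = X D (ra D.n (ix i)) (rb D.n (ix i)) := vecGen_e D
  have xf : ∀ i, vecGen D (.f i) = X D (rb D.n (ix i)) (ra D.n (ix i)) := vecGen_f D
  cases h <;> simp only [Free.e, Free.f, Free.w, Free.w', Free.wInv, Free.w'Inv, Free.t, map_mul,
    map_sub, map_add, map_smul, map_pow, map_one, map_zero, FreeAlgebra.lift_ι_apply]
  case torus_comm a b =>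
    obtain ⟨d, hd⟩ := tor_diag D a
    obtain ⟨d', hd'⟩ := tor_diag D b
    rw [hd, hd', Matrix.diagonal_mul_diagonal, Matrix.diagonal_mul_diagonal]
    simp only [mul_comm]
  case w_inv i => exact diagMat_mul_inv D hr hs _
  case w'_inv i => exact diagMat_mul_inv D hs hr _
  case w_e j i => exact diagMat_e D hr hs j i
  case w_f j i => exact diagMat_f D hr hs j i
  case w'_e j i => exact diagMat_e D hs hr j i
  case w'_f j i => exact diagMat_f D hs hr j i
  case e_f i => exact ef_same D i
  case e_f_ne i j hij => exact ef_ne D i j hij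
  case e_comm i j hij hc h1 h2 =>
    rw [xe, xe]
    rcases lt_or_gt_of_ne (fun h => hij (Fin.ext h) : (i : ℕ) ≠ j) with h | h
    · obtain ⟨a, b, -, -⟩ := X_comm_zero D D.n (ix i) (ix j) rfl (ix_mem i) (ix_mem j)
        (by simpa [ix] using h) hc h1
      rw [a, b]
    · obtain ⟨a, b, -, -⟩ := X_comm_zero D D.n (ix j) (ix i) rfl (ix_mem j) (ix_mem i)
        (by simpa [ix] using h) (by rw [cartan_symm]; exact hc) (fun h => h2 ⟨h.2, h.1⟩)
      rw [a, b]
  case f_comm i j hij hc h1 h2 =>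
    rw [xf, xf]
    rcases lt_or_gt_of_ne (fun h => hij (Fin.ext h) : (i : ℕ) ≠ j) with h | h
    · obtain ⟨-, -, a, b⟩ := X_comm_zero D D.n (ix i) (ix j) rfl (ix_mem i) (ix_mem j)
        (by simpa [ix] using h) hc h1
      rw [a, b]
    · obtain ⟨-, -, a, b⟩ := X_comm_zero D D.n (ix j) (ix i) rfl (ix_mem j) (ix_mem i)
        (by simpa [ix] using h) (by rw [cartan_symm]; exact hc) (fun h => h2 ⟨h.2, h.1⟩)
      rw [a, b]
  case e_last i j hi hj =>
    rw [xe, xe]; exact (last_rel D D.n _ _ rfl hi hj).1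
  case f_last i j hi hj =>
    rw [xf, xf]; exact (last_rel D D.n _ _ rfl hi hj).2
  case serre_e i j hij hc =>
    rw [xe, xe, (X_sq_zero D D.n _ rfl (ix_mem i)).1,
      (X_serre_zero D D.n (ix i) (ix j) rfl (ix_mem i) (ix_mem j) (by simpa [ix] using hij) hc).1]
    simp
  case serre_f i j hij hc =>
    rw [xf, xf, (X_sq_zero D D.n _ rfl (ix_mem i)).2, (X_serre_zero D D.n (ix i) (ix j) rfl
      (ix_mem i) (ix_mem j) (by simpa [ix] using hij) hc).2.2.1]
    simp
  case serre_e' i j hij hc =>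
    rw [xe, xe, (X_sq_zero D D.n _ rfl (ix_mem j)).1, (X_serre_zero D D.n (ix i) (ix j) rfl
      (ix_mem i) (ix_mem j) (by simpa [ix] using hij) hc).2.1]
    simp
  case serre_f' i j hij hc =>
    rw [xf, xf, (X_sq_zero D D.n _ rfl (ix_mem j)).2, (X_serre_zero D D.n (ix i) (ix j) rfl
      (ix_mem i) (ix_mem j) (by simpa [ix] using hij) hc).2.2.2]
    simp

end VecProof

/-- The vector representation `T₁` of `U_{r,s}(so_{2n})` by matrices. -/
def vecRep : U D →ₐ[K] Matrix (Fin (2 * D.n)) (Fin (2 * D.n)) K :=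
  RingQuot.liftAlgHom K ⟨FreeAlgebra.lift K (vecGen D), fun _ _ h => vecGen_rel D h⟩

section Coproduct

open U TensorProduct

theorem U.t_mul_t (a b : Tor D.n) : U.t D a * U.t D b = U.t D b * U.t D a := by
  have h := RingQuot.mkAlgHom_rel K (Rel.torus_comm (D := D) a b)
  rw [map_mul, map_mul] at h
  exact h

theorem U.w_e (j i : Fin D.n) : U.w D j * U.e D i =
    (D.r ^ expA D.n (ix j) (ix i) * D.s ^ expB D.n (ix j) (ix i)) • (U.e D i * U.w D j) := by
  have h := RingQuot.mkAlgHom_rel K (Rel.w_e (D := D) j i)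
  simp only [map_mul, map_smul] at h
  exact h

theorem U.w'_e (j i : Fin D.n) : U.w' D j * U.e D i =
    (D.s ^ expA D.n (ix j) (ix i) * D.r ^ expB D.n (ix j) (ix i)) • (U.e D i * U.w' D j) := by
  have h := RingQuot.mkAlgHom_rel K (Rel.w'_e (D := D) j i)
  simp only [map_mul, map_smul] at h
  exact h

theorem U.w_f (j i : Fin D.n) : U.w D j * U.f D i =
    (D.r ^ (-expA D.n (ix j) (ix i)) * D.s ^ (-expB D.n (ix j) (ix i))) •
      (U.f D i * U.w D j) := by
  have h := RingQuot.mkAlgHom_rel K (Rel.w_f (D := D) j i)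
  simp only [map_mul, map_smul] at h
  exact h

theorem U.w'_f (j i : Fin D.n) : U.w' D j * U.f D i =
    (D.s ^ (-expA D.n (ix j) (ix i)) * D.r ^ (-expB D.n (ix j) (ix i))) •
      (U.f D i * U.w' D j) := by
  have h := RingQuot.mkAlgHom_rel K (Rel.w'_f (D := D) j i)
  simp only [map_mul, map_smul] at h
  exact h

/-- The coproduct of a Serre relation, in an arbitrary algebra. -/
theorem serre_add {R : Type*} [Ring R] [Algebra K R] (A B C D : R) (q a b α β γ : K)
    (hBA : B * A = q • (A * B)) (hBC : B * C = a • (C * B)) (hDA : D * A = b • (A * D))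
    (h1 : γ • (A ^ 2 * C) - α • (A * C * A) + β • (C * A ^ 2) = 0)
    (h2 : γ • (B ^ 2 * D) - α • (B * D * B) + β • (D * B ^ 2) = 0)
    (c1 : γ - α * b + β * b ^ 2 = 0) (c2 : γ * (1 + q) * a - α = 0)
    (c3 : -α * a * q + β * (1 + q) = 0) (c4 : γ * (1 + q) - α * b * q = 0)
    (c5 : -α + β * b * (1 + q) = 0) (c6 : γ * a ^ 2 - α * a + β = 0) :
    γ • ((A + B) ^ 2 * (C + D)) - α • ((A + B) * (C + D) * (A + B))
      + β • ((C + D) * (A + B) ^ 2) = 0 := by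
  have hBA' : ∀ z, B * (A * z) = q • (A * (B * z)) := fun z => by
    rw [← mul_assoc, hBA, smul_mul_assoc, mul_assoc]
  have hBC' : ∀ z, B * (C * z) = a • (C * (B * z)) := fun z => by
    rw [← mul_assoc, hBC, smul_mul_assoc, mul_assoc]
  have hDA' : ∀ z, D * (A * z) = b • (A * (D * z)) := fun z => by
    rw [← mul_assoc, hDA, smul_mul_assoc, mul_assoc]
  have key : γ • ((A + B) ^ 2 * (C + D)) - α • ((A + B) * (C + D) * (A + B))
      + β • ((C + D) * (A + B) ^ 2) =
      (γ • (A ^ 2 * C) - α • (A * C * A) + β • (C * A ^ 2))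
      + (γ • (B ^ 2 * D) - α • (B * D * B) + β • (D * B ^ 2))
      + (γ - α * b + β * b ^ 2) • (A * (A * D)) + (γ * (1 + q) * a - α) • (A * (C * B))
      + (-α * a * q + β * (1 + q)) • (C * (A * B)) + (γ * (1 + q) - α * b * q) • (A * (B * D))
      + (-α + β * b * (1 + q)) • (A * (D * B)) + (γ * a ^ 2 - α * a + β) • (C * (B * B)) := by
    simp only [pow_two, add_mul, mul_add, mul_assoc, hBA, hBC, hDA, hBA', hBC', hDA',
      mul_smul_comm, smul_mul_assoc, smul_smul]
    module
  rw [key, h1, h2, c1, c2, c3, c4, c5, c6]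
  simp

theorem exp_self (n : ℕ) (hn : 3 ≤ n) (i : ℕ) (hi : 1 ≤ i ∧ i ≤ n) :
    expA n i i = 1 ∧ expB n i i = -1 := by
  unfold expA expB epsAlpha
  constructor <;> split_ifs <;> omega

theorem exp_antisymm (n : ℕ) (hn : 3 ≤ n) (i j : ℕ) (hi : 1 ≤ i ∧ i ≤ n) (hj : 1 ≤ j ∧ j ≤ n) :
    expA n i j = -expB n j i := by
  unfold expA expB epsAlpha
  by_cases h1 : i < n <;> by_cases h2 : j < n <;> simp only [h1, h2, if_true, if_false]
  all_goals split_ifs <;> omega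

theorem exp_adj (n : ℕ) (hn : 3 ≤ n) (i j : ℕ) (hi : 1 ≤ i ∧ i ≤ n) (hj : 1 ≤ j ∧ j ≤ n)
    (hij : i < j) (hc : cartan n i j = -1) :
    expA n i j = 0 ∧ expB n i j = 1 ∧ expA n j i = -1 ∧ expB n j i = 0 := by
  rw [cartan_eq n hn i j hi.1 hij hj.2] at hc
  have h1 : i < n := by omega
  by_cases h2 : j < n <;> simp only [h2, if_true, if_false] at hc
  · have : i + 1 = j := by by_contra h; simp [h] at hc
    unfold expA expB epsAlpha
    simp only [h1, h2, if_true]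
    refine ⟨?_, ?_, ?_, ?_⟩ <;> split_ifs <;> omega
  · have : i + 2 = n := by by_contra h; simp [h] at hc
    unfold expA expB epsAlpha
    simp only [h1, h2, if_true, if_false]
    refine ⟨?_, ?_, ?_, ?_⟩ <;> split_ifs <;> omega

theorem exp_comm (n : ℕ) (hn : 3 ≤ n) (i j : ℕ) (hi : 1 ≤ i ∧ i ≤ n) (hj : 1 ≤ j ∧ j ≤ n)
    (hij : i < j) (hc : cartan n i j = 0) (hl : ¬(i + 1 = n ∧ j = n)) :
    expA n i j = 0 ∧ expB n i j = 0 ∧ expA n j i = 0 ∧ expB n j i = 0 := by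
  rw [cartan_eq n hn i j hi.1 hij hj.2] at hc
  have h1 : i < n := by omega
  by_cases h2 : j < n <;> simp only [h2, if_true, if_false] at hc
  · have : i + 1 ≠ j := by intro h; simp [h] at hc
    unfold expA expB epsAlpha
    simp only [h1, h2, if_true]
    refine ⟨?_, ?_, ?_, ?_⟩ <;> split_ifs <;> omega
  · have : i + 2 ≠ n := by intro h; simp [h] at hc
    unfold expA expB epsAlpha
    simp only [h1, h2, if_true, if_false]
    refine ⟨?_, ?_, ?_, ?_⟩ <;> split_ifs <;> omega

theorem exp_comm' (n : ℕ) (hn : 3 ≤ n) (i j : ℕ) (hi : 1 ≤ i ∧ i ≤ n) (hj : 1 ≤ j ∧ j ≤ n)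
    (hij : i ≠ j) (hc : cartan n i j = 0) (h1 : ¬(i + 1 = n ∧ j = n))
    (h2 : ¬(i = n ∧ j + 1 = n)) :
    expA n i j = 0 ∧ expB n i j = 0 ∧ expA n j i = 0 ∧ expB n j i = 0 := by
  rcases lt_or_gt_of_ne hij with h | h
  · exact exp_comm n hn i j hi hj h hc h1
  · obtain ⟨a, b, c, d⟩ := exp_comm n hn j i hj hi h (by rw [cartan_symm]; exact hc)
      (fun h => h2 ⟨h.2, h.1⟩)
    exact ⟨c, d, a, b⟩

theorem exp_last (n : ℕ) (hn : 3 ≤ n) (i j : ℕ) (hi : i + 1 = n) (hj : j = n) :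
    expA n i j = 1 ∧ expB n i j = 1 ∧ expA n j i = -1 ∧ expB n j i = -1 := by
  unfold expA expB epsAlpha
  refine ⟨?_, ?_, ?_, ?_⟩ <;> split_ifs <;> omega

/-- The images of the generators under the coproduct satisfy the defining relations. -/
theorem comulGen_rel {x y : Free.A D} (h : Rel D x y) :
    FreeAlgebra.lift K (comulGen D) x = FreeAlgebra.lift K (comulGen D) y := by
  have hr := r_ne_zero D
  have hs := s_ne_zero D
  have hn := D.three_le
  have rel := RingQuot.mkAlgHom_rel K h
  have cw : ∀ i, comulGen D (.t (.w i)) = w D i ⊗ₜ w D i := fun i => rfl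
  have cw' : ∀ i, comulGen D (.t (.w' i)) = w' D i ⊗ₜ w' D i := fun i => rfl
  have ce : ∀ i, comulGen D (.e i) = e D i ⊗ₜ 1 + w D i ⊗ₜ e D i := fun i => rfl
  have cf : ∀ i, comulGen D (.f i) = 1 ⊗ₜ f D i + f D i ⊗ₜ w' D i := fun i => rfl
  have ww : ∀ i j, w D i * w D j = w D j * w D i := fun i j => U.t_mul_t D _ _
  have ww' : ∀ i j, w D i * w' D j = w' D j * w D i := fun i j => U.t_mul_t D _ _
  have w'w' : ∀ i j, w' D i * w' D j = w' D j * w' D i := fun i j => U.t_mul_t D _ _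
  have ww3 : ∀ i j, w D j * (w D i * w D i) = w D i * (w D i * w D j) := fun i j => by
    rw [← mul_assoc, ww j i, mul_assoc, ww j i]
  have w'w'3 : ∀ i j, w' D j * (w' D i * w' D i) = w' D i * (w' D i * w' D j) := fun i j => by
    rw [← mul_assoc, w'w' j i, mul_assoc, w'w' j i]
  cases h <;> simp only [map_mul, map_sub, map_add, map_smul, map_pow, map_one, map_zero] at rel ⊢
    <;> simp only [Free.e, Free.f, Free.w, Free.w', Free.wInv, Free.w'Inv, Free.t,
      FreeAlgebra.lift_ι_apply]
  case torus_comm a b =>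
    simp only [comulGen, Algebra.TensorProduct.tmul_mul_tmul, U.t_mul_t D a b]
  case w_inv i =>
    change (U.t D _ ⊗ₜ[K] U.t D _) * (U.t D _ ⊗ₜ[K] U.t D _) = 1
    change U.t D (.w i) * U.t D (.wInv i) = 1 at rel
    rw [Algebra.TensorProduct.tmul_mul_tmul, rel]; rfl
  case w'_inv i =>
    change (U.t D _ ⊗ₜ[K] U.t D _) * (U.t D _ ⊗ₜ[K] U.t D _) = 1
    change U.t D (.w' i) * U.t D (.w'Inv i) = 1 at rel
    rw [Algebra.TensorProduct.tmul_mul_tmul, rel]; rfl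
  case w_e j i =>
    simp only [cw, ce, mul_add, add_mul, Algebra.TensorProduct.tmul_mul_tmul, mul_one, one_mul,
      U.w_e, ww j i, smul_tmul', tmul_smul, smul_add]
  case w_f j i =>
    simp only [cw, cf, mul_add, add_mul, Algebra.TensorProduct.tmul_mul_tmul, mul_one, one_mul,
      U.w_f, ww' j i, smul_tmul', tmul_smul, smul_add]
  case w'_e j i =>
    simp only [cw', ce, mul_add, add_mul, Algebra.TensorProduct.tmul_mul_tmul, mul_one, one_mul,
      U.w'_e, ← ww' i j, smul_tmul', tmul_smul, smul_add]
  case w'_f j i =>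
    simp only [cw', cf, mul_add, add_mul, Algebra.TensorProduct.tmul_mul_tmul, mul_one, one_mul,
      U.w'_f, w'w' j i, smul_tmul', tmul_smul, smul_add]
  case e_f i =>
    change e D i * f D i - f D i * e D i = (D.r - D.s)⁻¹ • (w D i - w' D i) at rel
    have h1 : e D i * f D i = f D i * e D i + (D.r - D.s)⁻¹ • (w D i - w' D i) := by
      rw [← rel]; abel
    have hA := exp_self D.n hn (ix i) (ix_mem i)
    simp only [cw, cw', ce, cf, mul_add, add_mul, Algebra.TensorProduct.tmul_mul_tmul, mul_one,
      one_mul, h1, U.w'_e, U.w_f, hA.1, hA.2, add_tmul, tmul_add, smul_tmul', tmul_smul,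
      sub_tmul, tmul_sub, smul_sub]
    have hx : D.s ^ (1 : ℤ) * D.r ^ (-1 : ℤ) = D.r ^ (-(1 : ℤ)) * D.s ^ (-(-1 : ℤ)) := by
      rw [neg_neg]; ring
    rw [hx]
    abel
  case e_f_ne i j hij =>
    change e D i * f D j - f D j * e D i = 0 at rel
    have h1 : e D i * f D j = f D j * e D i := sub_eq_zero.mp rel
    simp only [ce, cf, mul_add, add_mul, Algebra.TensorProduct.tmul_mul_tmul, mul_one,
      one_mul, h1, U.w'_e, U.w_f, smul_tmul', tmul_smul]
    have hx : D.s ^ expA D.n (ix j) (ix i) * D.r ^ expB D.n (ix j) (ix i) =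
        D.r ^ (-expA D.n (ix i) (ix j)) * D.s ^ (-expB D.n (ix i) (ix j)) := by
      rw [exp_antisymm D.n hn (ix j) (ix i) (ix_mem j) (ix_mem i),
        exp_antisymm D.n hn (ix i) (ix j) (ix_mem i) (ix_mem j), neg_neg, mul_comm]
    rw [hx]
    abel
  case e_comm i j hij hc h1 h2 =>
    change e D i * e D j = e D j * e D i at rel
    obtain ⟨a, b, c, d⟩ := exp_comm' D.n hn (ix i) (ix j) (ix_mem i) (ix_mem j)
      (fun h => hij (Fin.ext (by simpa [ix] using h))) hc h1 h2
    simp only [ce, mul_add, add_mul, Algebra.TensorProduct.tmul_mul_tmul, mul_one, one_mul, rel,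
      U.w_e, a, b, c, d, zpow_zero, one_smul, ww i j]
    abel
  case f_comm i j hij hc h1 h2 =>
    change f D i * f D j = f D j * f D i at rel
    obtain ⟨a, b, c, d⟩ := exp_comm' D.n hn (ix i) (ix j) (ix_mem i) (ix_mem j)
      (fun h => hij (Fin.ext (by simpa [ix] using h))) hc h1 h2
    simp only [cf, mul_add, add_mul, Algebra.TensorProduct.tmul_mul_tmul, mul_one, one_mul, rel,
      U.w'_f, a, b, c, d, neg_zero, zpow_zero, one_smul, w'w' i j]
    abel
  case e_last i j hi hj =>
    change e D i * e D j = (D.r * D.s) • (e D j * e D i) at rel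
    obtain ⟨a, b, c, d⟩ := exp_last D.n hn (ix i) (ix j) hi hj
    have hx : D.r * D.s * (D.r⁻¹ * D.s⁻¹) = 1 := by field_simp
    simp only [ce, mul_add, add_mul, Algebra.TensorProduct.tmul_mul_tmul, mul_one, one_mul, rel,
      U.w_e, a, b, c, d, zpow_one, zpow_neg, ww i j, smul_add, smul_tmul', tmul_smul, smul_smul,
      hx, one_smul]
    abel
  case f_last i j hi hj =>
    change f D j * f D i = (D.r * D.s) • (f D i * f D j) at rel
    obtain ⟨a, b, c, d⟩ := exp_last D.n hn (ix i) (ix j) hi hj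
    have hx : D.r * D.s * (D.s⁻¹ * D.r⁻¹) = 1 := by field_simp
    simp only [cf, mul_add, add_mul, Algebra.TensorProduct.tmul_mul_tmul, mul_one, one_mul, rel,
      U.w'_f, a, b, c, d, zpow_one, zpow_neg, inv_inv, w'w' i j, smul_add, smul_tmul', tmul_smul,
      smul_smul, hx, one_smul]
    rw [mul_comm D.s D.r]
    abel
  case serre_e i j hij hc =>
    change e D i ^ 2 * e D j - (D.r + D.s) • (e D i * e D j * e D i)
        + (D.r * D.s) • (e D j * e D i ^ 2) = 0 at rel
    obtain ⟨a, b, c, d⟩ := exp_adj D.n hn (ix i) (ix j) (ix_mem i) (ix_mem j)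
      (by simpa [ix] using hij) hc
    have hA := exp_self D.n hn (ix i) (ix_mem i)
    rw [← one_smul K (comulGen D (.e i) ^ 2 * _), ce, ce]
    apply serre_add (R := U D ⊗[K] U D) _ _ _ _ (D.r * D.s⁻¹) D.s D.r⁻¹
    · simp only [Algebra.TensorProduct.tmul_mul_tmul, mul_one, one_mul, U.w_e, hA.1, hA.2,
        smul_tmul', zpow_one, zpow_neg]
    · simp only [Algebra.TensorProduct.tmul_mul_tmul, mul_one, one_mul, U.w_e, a, b,
        smul_tmul', zpow_one, zpow_zero]
    · simp only [Algebra.TensorProduct.tmul_mul_tmul, mul_one, one_mul, U.w_e, c, d,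
        smul_tmul', zpow_one, zpow_zero, zpow_neg]
    · simp only [pow_two, Algebra.TensorProduct.tmul_mul_tmul, mul_one] at rel ⊢
      simp only [one_smul, smul_tmul', ← sub_tmul, ← add_tmul, rel, zero_tmul]
    · simp only [pow_two, Algebra.TensorProduct.tmul_mul_tmul, mul_one] at rel ⊢
      simp only [one_smul, mul_assoc, ww j i, ww3 i j] at rel ⊢
      simp only [← tmul_smul, ← tmul_sub, ← tmul_add, rel, tmul_zero]
    all_goals field_simp
    all_goals ring
  case serre_e' i j hij hc =>
    change e D j ^ 2 * e D i - (D.r⁻¹ + D.s⁻¹) • (e D j * e D i * e D j)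
        + (D.r⁻¹ * D.s⁻¹) • (e D i * e D j ^ 2) = 0 at rel
    obtain ⟨a, b, c, d⟩ := exp_adj D.n hn (ix i) (ix j) (ix_mem i) (ix_mem j)
      (by simpa [ix] using hij) hc
    have hA := exp_self D.n hn (ix j) (ix_mem j)
    rw [← one_smul K (comulGen D (.e j) ^ 2 * _), ce, ce]
    apply serre_add (R := U D ⊗[K] U D) _ _ _ _ (D.r * D.s⁻¹) D.r⁻¹ D.s
    · simp only [Algebra.TensorProduct.tmul_mul_tmul, mul_one, one_mul, U.w_e, hA.1, hA.2,
        smul_tmul', zpow_one, zpow_neg]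
    · simp only [Algebra.TensorProduct.tmul_mul_tmul, mul_one, one_mul, U.w_e, c, d,
        smul_tmul', zpow_one, zpow_zero, zpow_neg]
    · simp only [Algebra.TensorProduct.tmul_mul_tmul, mul_one, one_mul, U.w_e, a, b,
        smul_tmul', zpow_one, zpow_zero]
    · simp only [pow_two, Algebra.TensorProduct.tmul_mul_tmul, mul_one] at rel ⊢
      simp only [one_smul, smul_tmul', ← sub_tmul, ← add_tmul, rel, zero_tmul]
    · simp only [pow_two, Algebra.TensorProduct.tmul_mul_tmul, mul_one] at rel ⊢
      simp only [one_smul, mul_assoc, ww i j, ww3 j i] at rel ⊢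
      simp only [← tmul_smul, ← tmul_sub, ← tmul_add, rel, tmul_zero]
    all_goals field_simp
    all_goals ring
  case serre_f i j hij hc =>
    change f D j * f D i ^ 2 - (D.r + D.s) • (f D i * f D j * f D i)
        + (D.r * D.s) • (f D i ^ 2 * f D j) = 0 at rel
    obtain ⟨a, b, c, d⟩ := exp_adj D.n hn (ix i) (ix j) (ix_mem i) (ix_mem j)
      (by simpa [ix] using hij) hc
    have hA := exp_self D.n hn (ix i) (ix_mem i)
    have rel' : (D.r * D.s) • (f D i ^ 2 * f D j) - (D.r + D.s) • (f D i * f D j * f D i)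
        + (1 : K) • (f D j * f D i ^ 2) = 0 := by rw [← rel, one_smul]; abel
    have swap : ∀ P Q R : U D ⊗[K] U D, P - Q + R = R - Q + (1 : K) • P := fun P Q R => by
      rw [one_smul]; abel
    rw [swap, cf, cf]
    apply serre_add (R := U D ⊗[K] U D) _ _ _ _ (D.r * D.s⁻¹) D.r⁻¹ D.s
    · simp only [Algebra.TensorProduct.tmul_mul_tmul, mul_one, one_mul, U.w'_f, hA.1, hA.2,
        tmul_smul, zpow_one, zpow_neg, inv_inv, mul_comm D.r]
    · simp only [Algebra.TensorProduct.tmul_mul_tmul, mul_one, one_mul, U.w'_f, a, b,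
        tmul_smul, zpow_one, zpow_zero, zpow_neg, neg_zero]
    · simp only [Algebra.TensorProduct.tmul_mul_tmul, mul_one, one_mul, U.w'_f, c, d,
        tmul_smul, zpow_one, zpow_zero, neg_neg, neg_zero]
    · simp only [pow_two, Algebra.TensorProduct.tmul_mul_tmul, mul_one] at rel' ⊢
      simp only [← tmul_smul, ← tmul_sub, ← tmul_add, rel', tmul_zero]
    · simp only [pow_two, Algebra.TensorProduct.tmul_mul_tmul, mul_one] at rel' ⊢
      simp only [mul_assoc, w'w' j i, w'w'3 i j] at rel' ⊢
      simp only [smul_tmul', ← sub_tmul, ← add_tmul, rel', zero_tmul]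
    all_goals field_simp
    all_goals ring
  case serre_f' i j hij hc =>
    change f D i * f D j ^ 2 - (D.r⁻¹ + D.s⁻¹) • (f D j * f D i * f D j)
        + (D.r⁻¹ * D.s⁻¹) • (f D j ^ 2 * f D i) = 0 at rel
    obtain ⟨a, b, c, d⟩ := exp_adj D.n hn (ix i) (ix j) (ix_mem i) (ix_mem j)
      (by simpa [ix] using hij) hc
    have hA := exp_self D.n hn (ix j) (ix_mem j)
    have rel' : (D.r⁻¹ * D.s⁻¹) • (f D j ^ 2 * f D i)
        - (D.r⁻¹ + D.s⁻¹) • (f D j * f D i * f D j)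
        + (1 : K) • (f D i * f D j ^ 2) = 0 := by rw [← rel, one_smul]; abel
    have swap : ∀ P Q R : U D ⊗[K] U D, P - Q + R = R - Q + (1 : K) • P := fun P Q R => by
      rw [one_smul]; abel
    rw [swap, cf, cf]
    apply serre_add (R := U D ⊗[K] U D) _ _ _ _ (D.r * D.s⁻¹) D.s D.r⁻¹
    · simp only [Algebra.TensorProduct.tmul_mul_tmul, mul_one, one_mul, U.w'_f, hA.1, hA.2,
        tmul_smul, zpow_one, zpow_neg, inv_inv, mul_comm D.r]
    · simp only [Algebra.TensorProduct.tmul_mul_tmul, mul_one, one_mul, U.w'_f, c, d,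
        tmul_smul, zpow_one, zpow_zero, neg_neg, neg_zero]
    · simp only [Algebra.TensorProduct.tmul_mul_tmul, mul_one, one_mul, U.w'_f, a, b,
        tmul_smul, zpow_one, zpow_zero, zpow_neg, neg_zero]
    · simp only [pow_two, Algebra.TensorProduct.tmul_mul_tmul, mul_one] at rel' ⊢
      simp only [← tmul_smul, ← tmul_sub, ← tmul_add, rel', tmul_zero]
    · simp only [pow_two, Algebra.TensorProduct.tmul_mul_tmul, mul_one] at rel' ⊢
      simp only [mul_assoc, w'w' i j, w'w'3 j i] at rel' ⊢
      simp only [smul_tmul', ← sub_tmul, ← add_tmul, rel', zero_tmul]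
    all_goals field_simp
    all_goals ring

/-- The coproduct `Δ` of `U_{r,s}(so_{2n})`. -/
def comul : U D →ₐ[K] U D ⊗[K] U D :=
  RingQuot.liftAlgHom K ⟨FreeAlgebra.lift K (comulGen D), fun _ _ h => comulGen_rel D h⟩

end Coproduct

section TensorSquare

open TensorProduct

/-- The action of `U_{r,s}(so_{2n})` on `V ⊗ V` through the coproduct. -/
def tensorAct : U D →ₐ[K] Module.End K (Vec D ⊗[K] Vec D) :=
  (Module.endTensorEndAlgHom (R := K) (S := K) (A := K) (M := Vec D) (N := Vec D)).comp
    ((Algebra.TensorProduct.map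
      ((Matrix.toLinAlgEquiv' : Matrix _ _ K ≃ₐ[K] Module.End K (Vec D)).toAlgHom.comp (vecRep D))
      ((Matrix.toLinAlgEquiv' : Matrix _ _ K ≃ₐ[K] Module.End K (Vec D)).toAlgHom.comp
        (vecRep D))).comp (comul D))

/-- The `U_{r,s}(so_{2n})`-module `V ⊗ V`. -/
def VV : Type _ := Vec D ⊗[K] Vec D

instance : AddCommGroup (VV D) := inferInstanceAs (AddCommGroup (Vec D ⊗[K] Vec D))

instance : Module K (VV D) := inferInstanceAs (Module K (Vec D ⊗[K] Vec D))

instance : Module (U D) (VV D) :=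
  Module.compHom (Vec D ⊗[K] Vec D) (tensorAct D).toRingHom

theorem U_smul_def (u : U D) (x : VV D) : u • x = tensorAct D u x := rfl

instance : IsScalarTower K (U D) (VV D) where
  smul_assoc c u x := by
    rw [U_smul_def, U_smul_def, map_smul]
    rfl

/-- `v_i ⊗ v_j`, with 1-based indices. -/
def vv (i j : ℕ) : VV D := v D i ⊗ₜ[K] v D j

/-- Twice the exponent of `r s⁻¹` in `a_i`: `n - i` for `1 ≤ i ≤ n`, `0` for
`i = n + 1`, `n - i + 1` for `n + 2 ≤ i ≤ 2n`. -/
def aExp (n i : ℕ) : ℤ :=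
  if i ≤ n then (n : ℤ) - i else if i = n + 1 then 0 else (n : ℤ) - i + 1

/-- `a_i`, a power of `(r s⁻¹)^(1/2)`. -/
def aCoef (i : ℕ) : K := (D.rh * D.sh⁻¹) ^ aExp D.n i

/-- `∑ a_i v_{i'} ⊗ v_i`. -/
def omega : VV D := ∑ i ∈ Finset.Icc 1 (2 * D.n), aCoef D i • vv D (pr D i) i

/-- The first family of index pairs: `1 ≤ i ≤ n` and `i + 1 ≤ j ≤ n` or `i' + 1 ≤ j ≤ 2n`. -/
def pairsA (n : ℕ) : Set (ℕ × ℕ) :=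
  {p | (1 ≤ p.1 ∧ p.1 ≤ n) ∧
    ((p.1 + 1 ≤ p.2 ∧ p.2 ≤ n) ∨ ((2 * n + 1 - p.1) + 1 ≤ p.2 ∧ p.2 ≤ 2 * n))}

/-- The second family of index pairs: `1 ≤ i ≤ n - 1`, `n + 1 ≤ j ≤ 2n - i`, or
`n + 1 ≤ i ≤ 2n - 1`, `i + 1 ≤ j ≤ 2n`. -/
def pairsB (n : ℕ) : Set (ℕ × ℕ) :=
  {p | ((1 ≤ p.1 ∧ p.1 ≤ n - 1) ∧ (n + 1 ≤ p.2 ∧ p.2 ≤ 2 * n - p.1)) ∨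
    ((n + 1 ≤ p.1 ∧ p.1 ≤ 2 * n - 1) ∧ (p.1 + 1 ≤ p.2 ∧ p.2 ≤ 2 * n))}

/-- The vectors spanning `S'(V ⊗ V)`. -/
def symVectors : Set (VV D) :=
  {x | ∃ i, 1 ≤ i ∧ i ≤ 2 * D.n ∧ x = vv D i i}
  ∪ {x | ∃ p ∈ pairsA D.n, x = vv D p.1 p.2 + D.s • vv D p.2 p.1}
  ∪ {x | ∃ p ∈ pairsB D.n, x = vv D p.1 p.2 + D.r⁻¹ • vv D p.2 p.1}
  ∪ {x | ∃ i, 1 ≤ i ∧ i ≤ D.n - 1 ∧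
      x = vv D i (pr D i) + (D.r⁻¹ * D.s) • vv D (pr D i) i
        - (D.rh⁻¹ * D.sh) • (vv D (pr D (i + 1)) (i + 1) + vv D (i + 1) (pr D (i + 1)))}

/-- The vectors generating `Λ(V ⊗ V)`. -/
def altVectors : Set (VV D) :=
  {x | ∃ p ∈ pairsA D.n, x = vv D p.1 p.2 - D.r • vv D p.2 p.1}
  ∪ {x | ∃ p ∈ pairsB D.n, x = vv D p.1 p.2 - D.s⁻¹ • vv D p.2 p.1}
  ∪ {x | ∃ i, 1 ≤ i ∧ i ≤ D.n - 1 ∧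
      x = -((D.rh⁻¹ * D.sh⁻¹) • vv D i (pr D i)) - D.s⁻¹ • vv D (pr D (i + 1)) (i + 1)
        + D.r⁻¹ • vv D (i + 1) (pr D (i + 1)) + (D.rh⁻¹ * D.sh⁻¹) • vv D (pr D i) i}

/-- `S°(V ⊗ V)`, the submodule generated by `∑ a_i v_{i'} ⊗ v_i`. -/
def SO : Submodule (U D) (VV D) := Submodule.span (U D) {omega D}

/-- `S'(V ⊗ V)`. -/
def SPrime : Submodule (U D) (VV D) := Submodule.span (U D) (symVectors D)

/-- `Λ(V ⊗ V)`. -/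
def Lam : Submodule (U D) (VV D) := Submodule.span (U D) (altVectors D)

/-- `x` is a highest weight vector of the submodule `N`: a nonzero weight vector killed by all
`e_i` which generates `N`. -/
structure IsHighestWeightVector (N : Submodule (U D) (VV D)) (x : VV D) : Prop where
  ne_zero : x ≠ 0
  e_smul : ∀ i, U.e D i • x = 0
  w_smul : ∀ i, ∃ c : K, U.w D i • x = c • x
  w'_smul : ∀ i, ∃ c : K, U.w' D i • x = c • x
  span_eq : Submodule.span (U D) {x} = N

end TensorSquare

end TwoParamD

end

/-! The proof rests on three singular vectors (torus eigenvectors killed by all `e_i`):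
`ω`, `v₁ ⊗ v₁` and `v₁ ⊗ v₂ - r v₂ ⊗ v₁`. They span the joint kernel of the `e_i` on `V ⊗ V`
(`eq_zero_of_e_smul_eq_zero`, `eq_sum_hw`), and since the `e_i` are nilpotent, every nonzero
submodule of `V ⊗ V` meets that kernel (`exists_e_smul_eq_zero`).

Dually there are three functionals vanishing on the images of all `f_i`: the invariant functional
`trace`, the coordinate at `v₁ ⊗ v₁`, and `s v₁₂* - v₂₁*`. Each is nonzero on one singular vector
and zero on the other two; for `trace` and `ω` the pairing is the quantum dimension of `V`, nonzero by
the algebraic independence of `r` and `s`. A submodule generated by a singular vector is spanned by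
the vectors obtained from it by applying `f_i`'s (`IsSingular.span_le`), so two of the functionals
vanish on it. Hence a nonzero submodule of it contains its singular vector, which makes it simple
(`isAtom_span_hw`), and the three submodules are independent (`iSupIndep_span_hw`).

It remains to locate the listed vectors. Applying `f_i`'s to the singular vectors produces all of
them (`twist_mem_of_lt_pr`, `twist_mem_pr`, `zeroWeight_mem`, `vv_self_mem`), and together they span
`V ⊗ V`: a functional vanishing on the lists of `S'` and `Λ` is a multiple of `trace`, and it
vanishes at `ω` too only if it is zero (`iSup_span_spanVectors`). Families of vectors inside
independent submodules which together span the whole space span each of these submodules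
(`restrictScalars_span_hw`), so no direct check that the spans are stable under `U` is needed. -/

noncomputable section

namespace TwoParamD

variable {K : Type*} [Field K] [CharZero K] (D : Datum K)

/-! ### The action of the generators in coordinates -/

/-- The `a`-th coordinate of a vector, `1 ≤ a ≤ 2n` (and zero for other `a`). -/
def vcoord (a : ℕ) : Vec D →ₗ[K] K :=
  if h : 1 ≤ a ∧ a ≤ 2 * D.n then LinearMap.proj ⟨a - 1, by omega⟩ else 0

theorem vcoord_v (a b : ℕ) (ha : 1 ≤ a ∧ a ≤ 2 * D.n) :
    vcoord D a (v D b) = if a = b then 1 else 0 := by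
  have : a - 1 + 1 = a := by omega
  simp only [vcoord, dif_pos ha, LinearMap.proj_apply, v, this]

theorem vcoord_E (a k l : ℕ) (ha : 1 ≤ a ∧ a ≤ 2 * D.n) (x : Vec D) :
    vcoord D a (Matrix.mulVec (E D k l) x) = if a = k then vcoord D l x else 0 := by
  have h1 : a - 1 + 1 = a := by omega
  rw [vcoord, dif_pos ha]
  simp only [LinearMap.proj_apply, Matrix.mulVec, dotProduct, E, Matrix.of_apply, h1]
  by_cases hk : a = k
  · simp only [hk, true_and, if_true, ite_mul, one_mul, zero_mul]
    by_cases hl : 1 ≤ l ∧ l ≤ 2 * D.n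
    · rw [vcoord, dif_pos hl, Finset.sum_eq_single (⟨l - 1, by omega⟩ : Fin (2 * D.n))]
      · have : l - 1 + 1 = l := by omega
        simp [this]
      · intro b _ hb
        rw [if_neg]
        exact fun h => hb (Fin.ext (by simp; omega))
      · simp
    · rw [vcoord, dif_neg hl, LinearMap.zero_apply]
      refine Finset.sum_eq_zero fun b _ => if_neg ?_
      have := b.2
      omega
  · simp [hk]

theorem vcoord_diagonal (a : ℕ) (g : ℕ → K) (x : Vec D) :
    vcoord D a (Matrix.mulVec (Matrix.diagonal fun i : Fin (2 * D.n) => g ((i : ℕ) + 1)) x)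
      = g a * vcoord D a x := by
  by_cases ha : 1 ≤ a ∧ a ≤ 2 * D.n
  · have h1 : a - 1 + 1 = a := by omega
    simp only [vcoord, dif_pos ha, LinearMap.proj_apply, Matrix.mulVec_diagonal, h1]
  · simp only [vcoord, dif_neg ha, LinearMap.zero_apply, mul_zero]

/-- The pure tensor `x ⊗ y`, as an element of the `U`-module `V ⊗ V`. -/
def tm (x y : Vec D) : VV D := x ⊗ₜ[K] y

theorem vv_induction {p : VV D → Prop} (x : VV D) (tmul : ∀ y z, p (tm D y z))
    (add : ∀ y z, p y → p z → p (y + z)) : p x := by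
  refine TensorProduct.induction_on (motive := p) x ?_ tmul add
  have h := tmul 0 0
  rwa [tm, TensorProduct.zero_tmul] at h

/-- The coefficient of `v_a ⊗ v_b`. -/
def coord (a b : ℕ) : VV D →ₗ[K] K :=
  (LinearMap.mul' K K ∘ₗ TensorProduct.map (vcoord D a) (vcoord D b) : Vec D ⊗[K] Vec D →ₗ[K] K)

theorem coord_tm (a b : ℕ) (x y : Vec D) :
    coord D a b (tm D x y) = vcoord D a x * vcoord D b y := by
  change (LinearMap.mul' K K ∘ₗ TensorProduct.map (vcoord D a) (vcoord D b)) (x ⊗ₜ[K] y) = _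
  rw [LinearMap.comp_apply, TensorProduct.map_tmul, LinearMap.mul'_apply]

theorem coord_vv (a b k l : ℕ) (ha : 1 ≤ a ∧ a ≤ 2 * D.n) (hb : 1 ≤ b ∧ b ≤ 2 * D.n) :
    coord D a b (vv D k l) = if a = k ∧ b = l then 1 else 0 := by
  change coord D a b (tm D _ _) = _
  rw [coord_tm, vcoord_v D a k ha, vcoord_v D b l hb]
  split_ifs <;> simp_all

/-- The elements `v_a ⊗ v_b` span `V ⊗ V`. -/
theorem span_vv : Submodule.span K
    {x | ∃ a b, (1 ≤ a ∧ a ≤ 2 * D.n) ∧ (1 ≤ b ∧ b ≤ 2 * D.n) ∧ x = vv D a b} = ⊤ := by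
  have hv : ∀ k : Fin (2 * D.n), Pi.basisFun K (Fin (2 * D.n)) k = v D (k + 1) := by
    intro k
    funext l
    simp only [Pi.basisFun_apply, Pi.single_apply, v, Fin.ext_iff, Nat.add_right_cancel_iff]
  have h := ((Pi.basisFun K (Fin (2 * D.n))).tensorProduct (Pi.basisFun K (Fin (2 * D.n)))).span_eq
  refine top_le_iff.1 (h.symm.le.trans (Submodule.span_mono ?_))
  rintro _ ⟨⟨k, l⟩, rfl⟩
  have := k.2
  have := l.2
  refine ⟨k + 1, l + 1, by omega, by omega, ?_⟩
  rw [Module.Basis.tensorProduct_apply, hv, hv]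
  rfl

theorem eq_sum_coord (x : VV D) : x = ∑ a ∈ Finset.Icc 1 (2 * D.n), ∑ b ∈ Finset.Icc 1 (2 * D.n),
    coord D a b x • vv D a b := by
  have hx : x ∈ Submodule.span K
      {x | ∃ a b, (1 ≤ a ∧ a ≤ 2 * D.n) ∧ (1 ≤ b ∧ b ≤ 2 * D.n) ∧ x = vv D a b} := by
    rw [span_vv]; trivial
  induction hx using Submodule.span_induction with
  | mem x h =>
    obtain ⟨k, l, hk, hl, rfl⟩ := h
    rw [Finset.sum_eq_single k, Finset.sum_eq_single l]
    · rw [coord_vv D k l k l hk hl, if_pos ⟨rfl, rfl⟩, one_smul]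
    · intro b hb hbl
      rw [coord_vv D k b k l hk (Finset.mem_Icc.1 hb), if_neg (fun h => hbl h.2), zero_smul]
    · exact fun h => absurd (Finset.mem_Icc.2 hl) h
    · intro a ha hak
      refine Finset.sum_eq_zero fun b hb => ?_
      rw [coord_vv D a b k l (Finset.mem_Icc.1 ha) (Finset.mem_Icc.1 hb),
        if_neg (fun h => hak h.1), zero_smul]
    · exact fun h => absurd (Finset.mem_Icc.2 hk) h
  | zero => simp
  | add x y _ _ hx hy =>
    simp only [map_add, add_smul, Finset.sum_add_distrib]
    rw [← hx, ← hy]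
  | smul c x _ hx =>
    conv_lhs => rw [hx]
    simp only [map_smul, smul_assoc, Finset.smul_sum]

theorem ext_coord {x y : VV D} (h : ∀ a b, 1 ≤ a ∧ a ≤ 2 * D.n → 1 ≤ b ∧ b ≤ 2 * D.n →
    coord D a b x = coord D a b y) : x = y := by
  rw [eq_sum_coord D x, eq_sum_coord D y]
  refine Finset.sum_congr rfl fun a ha => Finset.sum_congr rfl fun b hb => ?_
  rw [h a b (Finset.mem_Icc.1 ha) (Finset.mem_Icc.1 hb)]

theorem comul_mk (g : Gen D.n) : comul D (U.mk D (FreeAlgebra.ι K g)) = comulGen D g := by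
  rw [comul, U.mk, RingQuot.liftAlgHom_mkAlgHom_apply, FreeAlgebra.lift_ι_apply]

theorem vecRep_mk (g : Gen D.n) : vecRep D (U.mk D (FreeAlgebra.ι K g)) = vecGen D g := by
  rw [vecRep, U.mk, RingQuot.liftAlgHom_mkAlgHom_apply, FreeAlgebra.lift_ι_apply]

theorem e_smul_tm (i : Fin D.n) (x y : Vec D) :
    U.e D i • tm D x y = tm D ((vecGen D (.e i)).mulVec x) y
      + tm D ((vecGen D (.t (.w i))).mulVec x) ((vecGen D (.e i)).mulVec y) := by
  have h := comul_mk D (.e i)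
  have h1 : vecRep D (U.e D i) = _ := vecRep_mk D (.e i)
  have h2 : vecRep D (U.w D i) = _ := vecRep_mk D (.t (.w i))
  rw [U_smul_def, tensorAct, AlgHom.comp_apply, AlgHom.comp_apply]
  change (Module.endTensorEndAlgHom (R := K) (S := K) (A := K) (M := Vec D) (N := Vec D))
    (Algebra.TensorProduct.map _ _ (comul D (U.mk D (FreeAlgebra.ι K (.e i)))))
      (x ⊗ₜ[K] y) = _
  rw [h]
  simp [comulGen, h1, h2]
  rfl

theorem f_smul_tm (i : Fin D.n) (x y : Vec D) :
    U.f D i • tm D x y = tm D x ((vecGen D (.f i)).mulVec y)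
      + tm D ((vecGen D (.f i)).mulVec x) ((vecGen D (.t (.w' i))).mulVec y) := by
  have h := comul_mk D (.f i)
  have h1 : vecRep D (U.f D i) = _ := vecRep_mk D (.f i)
  have h2 : vecRep D (U.w' D i) = _ := vecRep_mk D (.t (.w' i))
  rw [U_smul_def, tensorAct, AlgHom.comp_apply, AlgHom.comp_apply]
  change (Module.endTensorEndAlgHom (R := K) (S := K) (A := K) (M := Vec D) (N := Vec D))
    (Algebra.TensorProduct.map _ _ (comul D (U.mk D (FreeAlgebra.ι K (.f i)))))
      (x ⊗ₜ[K] y) = _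
  rw [h]
  simp [comulGen, h1, h2]
  rfl

theorem t_smul_tm (a : Tor D.n) (x y : Vec D) :
    U.t D a • tm D x y = tm D ((vecGen D (.t a)).mulVec x) ((vecGen D (.t a)).mulVec y) := by
  have h := comul_mk D (.t a)
  have h1 : vecRep D (U.t D a) = _ := vecRep_mk D (.t a)
  rw [U_smul_def, tensorAct, AlgHom.comp_apply, AlgHom.comp_apply]
  change (Module.endTensorEndAlgHom (R := K) (S := K) (A := K) (M := Vec D) (N := Vec D))
    (Algebra.TensorProduct.map _ _ (comul D (U.mk D (FreeAlgebra.ι K (.t a)))))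
      (x ⊗ₜ[K] y) = _
  rw [h]
  simp [comulGen, h1]
  rfl

/-- The constant `(rs)^(-1/2)`. -/
def cc : K := D.rh⁻¹ * D.sh⁻¹

/-- The `i`-th generator index, for a 1-based `i`. -/
def gi (i : ℕ) (h : 1 ≤ i ∧ i ≤ D.n) : Fin D.n := ⟨i - 1, by omega⟩

theorem ix_gi (i : ℕ) (h : 1 ≤ i ∧ i ≤ D.n) : ix (gi D i h) = i := by
  simp only [gi, ix]; omega

theorem coord_e (i : Fin D.n) (a b : ℕ) (ha : 1 ≤ a ∧ a ≤ 2 * D.n) (hb : 1 ≤ b ∧ b ≤ 2 * D.n)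
    (x : VV D) : coord D a b (U.e D i • x) =
      (if a = ra D.n (ix i) then coord D (rb D.n (ix i)) b x else 0)
      - cc D * (if a = pr D (rb D.n (ix i)) then coord D (pr D (ra D.n (ix i))) b x else 0)
      + diagEntry D.n D.r D.s (ix i) a *
        ((if b = ra D.n (ix i) then coord D a (rb D.n (ix i)) x else 0)
        - cc D * (if b = pr D (rb D.n (ix i)) then coord D a (pr D (ra D.n (ix i))) x else 0)) := by
  induction x using vv_induction D with
  | tmul x y =>
    rw [e_smul_tm, map_add]
    simp only [coord_tm]
    rw [vecGen_e]
    simp only [vecGen, diagMat, vcoord_diagonal, Matrix.sub_mulVec, Matrix.smul_mulVec, map_sub,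
      map_smul, vcoord_E D _ _ _ ha, vcoord_E D _ _ _ hb, smul_eq_mul, cc]
    grind
  | add x y hx hy =>
    rw [smul_add, map_add, hx, hy]
    simp only [map_add]
    grind

theorem coord_f (i : Fin D.n) (a b : ℕ) (ha : 1 ≤ a ∧ a ≤ 2 * D.n) (hb : 1 ≤ b ∧ b ≤ 2 * D.n)
    (x : VV D) : coord D a b (U.f D i • x) =
      (if b = rb D.n (ix i) then coord D a (ra D.n (ix i)) x else 0)
      - cc D * (if b = pr D (ra D.n (ix i)) then coord D a (pr D (rb D.n (ix i))) x else 0)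
      + diagEntry D.n D.s D.r (ix i) b *
        ((if a = rb D.n (ix i) then coord D (ra D.n (ix i)) b x else 0)
        - cc D * (if a = pr D (ra D.n (ix i)) then coord D (pr D (rb D.n (ix i))) b x else 0)) := by
  induction x using vv_induction D with
  | tmul x y =>
    rw [f_smul_tm, map_add]
    simp only [coord_tm]
    rw [vecGen_f]
    simp only [vecGen, diagMat, vcoord_diagonal, Matrix.sub_mulVec, Matrix.smul_mulVec, map_sub,
      map_smul, vcoord_E D _ _ _ ha, vcoord_E D _ _ _ hb, smul_eq_mul, cc]
    grind
  | add x y hx hy =>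
    rw [smul_add, map_add, hx, hy]
    simp only [map_add]
    grind

/-- The `U`-action is determined by that of the generators: a subspace stable under these is
stable under `U`. -/
theorem smul_mem_of_generators (T : Submodule K (VV D))
    (he : ∀ i, ∀ x ∈ T, U.e D i • x ∈ T) (hf : ∀ i, ∀ x ∈ T, U.f D i • x ∈ T)
    (ht : ∀ a, ∀ x ∈ T, U.t D a • x ∈ T) (u : U D) : ∀ x ∈ T, u • x ∈ T := by
  obtain ⟨u, rfl⟩ := RingQuot.mkAlgHom_surjective K (Rel D) u
  change ∀ x ∈ T, U.mk D u • x ∈ T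
  induction u using FreeAlgebra.induction with
  | grade0 c =>
    intro x hx
    rw [AlgHom.commutes, algebraMap_smul]
    exact T.smul_mem c hx
  | grade1 g =>
    cases g with
    | e i => exact he i
    | f i => exact hf i
    | t a => exact ht a
  | mul u v hu hv =>
    intro x hx
    rw [map_mul, mul_smul]
    exact hu _ (hv _ hx)
  | add u v hu hv =>
    intro x hx
    rw [map_add, add_smul]
    exact T.add_mem (hu _ hx) (hv _ hx)

/-! ### Submodules generated by highest weight vectors -/

theorem exists_commute_inv {R : Type*} [Ring R] [Algebra K R] {w u f : R} {c : K} (hc : c ≠ 0)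
    (h : w * f = c • (f * w)) (h1 : w * u = 1) (h2 : u * w = 1) : u * f = c⁻¹ • (f * u) := by
  have : f * u = c • (u * f) := by
    calc f * u = u * (w * f) * u := by rw [← mul_assoc, h2, one_mul]
      _ = c • (u * f * (w * u)) := by rw [h]; simp only [mul_smul_comm, smul_mul_assoc, mul_assoc]
      _ = c • (u * f) := by rw [h1, mul_one]
  rw [this, smul_smul, inv_mul_cancel₀ hc, one_smul]

theorem exists_t_mul_f (a : Tor D.n) (i : Fin D.n) :
    ∃ c : K, U.t D a * U.f D i = c • (U.f D i * U.t D a) := by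
  have hr := r_ne_zero D
  have hs := s_ne_zero D
  cases a with
  | w j => exact ⟨_, U.w_f D j i⟩
  | w' j => exact ⟨_, U.w'_f D j i⟩
  | wInv j =>
    have h : U.t D (.w j) * U.t D (.wInv j) = 1 := by
      have h := RingQuot.mkAlgHom_rel K (Rel.w_inv (D := D) j)
      rwa [map_mul, map_one] at h
    exact ⟨_, exists_commute_inv (mul_ne_zero (zpow_ne_zero _ hr) (zpow_ne_zero _ hs))
      (U.w_f D j i) h ((U.t_mul_t D _ _).trans h)⟩
  | w'Inv j =>
    have h : U.t D (.w' j) * U.t D (.w'Inv j) = 1 := by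
      have h := RingQuot.mkAlgHom_rel K (Rel.w'_inv (D := D) j)
      rwa [map_mul, map_one] at h
    exact ⟨_, exists_commute_inv (mul_ne_zero (zpow_ne_zero _ hs) (zpow_ne_zero _ hr))
      (U.w'_f D j i) h ((U.t_mul_t D _ _).trans h)⟩

theorem e_smul_f_smul (i j : Fin D.n) (x : VV D) : ∃ c : K,
    U.e D i • U.f D j • x = U.f D j • U.e D i • x + c • (U.w D i • x - U.w' D i • x) := by
  by_cases hij : i = j
  · subst hij
    refine ⟨(D.r - D.s)⁻¹, ?_⟩
    have h := RingQuot.mkAlgHom_rel K (Rel.e_f (D := D) i)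
    simp only [map_mul, map_sub, map_smul] at h
    change U.e D i * U.f D i - U.f D i * U.e D i = (D.r - D.s)⁻¹ • (U.w D i - U.w' D i) at h
    rw [← mul_smul, ← mul_smul, sub_eq_iff_eq_add'.1 h, add_smul, smul_assoc, sub_smul]
  · refine ⟨0, ?_⟩
    have h := RingQuot.mkAlgHom_rel K (Rel.e_f_ne (D := D) i j hij)
    simp only [map_mul, map_sub, map_zero] at h
    change U.e D i * U.f D j - U.f D j * U.e D i = 0 at h
    rw [← mul_smul, ← mul_smul, sub_eq_zero.1 h, zero_smul, add_zero]

/-- The vectors `f_{i₁} ⋯ f_{iₖ} x`. -/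
inductive FWord (x : VV D) : VV D → Prop
  | base : FWord x x
  | step (i : Fin D.n) {y : VV D} : FWord x y → FWord x (U.f D i • y)

/-- A common eigenvector of the torus which is killed by all `e_i`. -/
structure IsSingular (x : VV D) : Prop where
  e_smul : ∀ i, U.e D i • x = 0
  t_smul : ∀ a, ∃ c : K, U.t D a • x = c • x

variable {D}

theorem FWord.t_smul {x y : VV D} (hx : IsSingular D x) (hy : FWord D x y) (a : Tor D.n) :
    ∃ c : K, U.t D a • y = c • y := by
  induction hy with
  | base => exact hx.t_smul a
  | step i _ ih =>
    obtain ⟨c, hc⟩ := ih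
    obtain ⟨d, hd⟩ := exists_t_mul_f D a i
    exact ⟨d * c, by rw [← mul_smul, hd, smul_assoc, mul_smul, hc, smul_comm _ c, smul_smul]⟩

theorem f_smul_mem_span_fWord {x : VV D} (i : Fin D.n) {y : VV D}
    (hy : y ∈ Submodule.span K {y | FWord D x y}) :
    U.f D i • y ∈ Submodule.span K {y | FWord D x y} := by
  induction hy using Submodule.span_induction with
  | mem y hy => exact Submodule.subset_span (FWord.step i hy)
  | zero => rw [smul_zero]; exact zero_mem _
  | add y z _ _ hy hz => rw [smul_add]; exact add_mem hy hz
  | smul c y _ hy => rw [smul_comm]; exact Submodule.smul_mem _ c hy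

theorem FWord.e_smul_mem {x y : VV D} (hx : IsSingular D x) (hy : FWord D x y) (i : Fin D.n) :
    U.e D i • y ∈ Submodule.span K {y | FWord D x y} := by
  induction hy with
  | base => rw [hx.e_smul i]; exact zero_mem _
  | @step j y hy ih =>
    obtain ⟨c, hc⟩ := e_smul_f_smul D i j y
    obtain ⟨a, ha⟩ := hy.t_smul hx (.w i)
    obtain ⟨b, hb⟩ := hy.t_smul hx (.w' i)
    change U.w D i • y = a • y at ha
    change U.w' D i • y = b • y at hb
    have hy' : y ∈ Submodule.span K {y | FWord D x y} := Submodule.subset_span hy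
    rw [hc, ha, hb]
    exact add_mem (f_smul_mem_span_fWord j ih) (Submodule.smul_mem _ c
      (sub_mem (Submodule.smul_mem _ _ hy') (Submodule.smul_mem _ _ hy')))

/-- The submodule generated by a singular vector `x` is spanned by the vectors
`f_{i₁} ⋯ f_{iₖ} x`: moving an `e_i` to the right through the `f_j` only produces shorter words. -/
theorem IsSingular.span_le {x : VV D} (hx : IsSingular D x) :
    (Submodule.span (U D) {x}).restrictScalars K ≤ Submodule.span K {y | FWord D x y} := by
  have key := smul_mem_of_generators D (Submodule.span K {y | FWord D x y}) ?_
    (fun i y hy => f_smul_mem_span_fWord i hy) ?_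
  · intro y hy
    obtain ⟨u, rfl⟩ := Submodule.mem_span_singleton.1 hy
    exact key u x (Submodule.subset_span .base)
  · intro i y hy
    induction hy using Submodule.span_induction with
    | mem y hy => exact hy.e_smul_mem hx i
    | zero => rw [smul_zero]; exact zero_mem _
    | add y z _ _ hy hz => rw [smul_add]; exact add_mem hy hz
    | smul c y _ hy => rw [smul_comm]; exact Submodule.smul_mem _ c hy
  · intro a y hy
    induction hy using Submodule.span_induction with
    | mem y hy =>
      obtain ⟨c, hc⟩ := hy.t_smul hx a
      rw [hc]
      exact Submodule.smul_mem _ c (Submodule.subset_span hy)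
    | zero => rw [smul_zero]; exact zero_mem _
    | add y z _ _ hy hz => rw [smul_add]; exact add_mem hy hz
    | smul c y _ hy => rw [smul_comm]; exact Submodule.smul_mem _ c hy

/-- A functional vanishing on a singular vector `x` and on the images of all `f_i` vanishes on the
submodule generated by `x`. -/
theorem IsSingular.apply_eq_zero {x : VV D} (hx : IsSingular D x) {φ : VV D →ₗ[K] K}
    (h0 : φ x = 0) (h1 : ∀ i y, φ (U.f D i • y) = 0) {y : VV D}
    (hy : y ∈ Submodule.span (U D) {x}) : φ y = 0 := by
  have h : Submodule.span K {y | FWord D x y} ≤ LinearMap.ker φ := by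
    refine Submodule.span_le.2 fun y hy => ?_
    change φ y = 0
    cases hy with
    | base => exact h0
    | step i _ => exact h1 i _
  exact h (hx.span_le hy)

variable (D)

/-! ### Vectors killed by all raising operators -/

theorem ra_lt_rb (i : ℕ) : ra D.n i < rb D.n i := by
  unfold ra rb; split_ifs <;> omega

/-- If the coordinates `(a, b)` of `x` with `k < a + b` vanish, those of `e_i x` with
`k ≤ a + b` do. -/
theorem coord_e_eq_zero_of_lt {k : ℕ} {x : VV D} (hx : ∀ a b, k < a + b → coord D a b x = 0)
    (i : Fin D.n) (a b : ℕ) (ha : 1 ≤ a ∧ a ≤ 2 * D.n) (hb : 1 ≤ b ∧ b ≤ 2 * D.n)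
    (hab : k ≤ a + b) : coord D a b (U.e D i • x) = 0 := by
  have h := ra_lt_rb D (ix i)
  obtain ⟨m1, m2, m3, m4⟩ := ra_mem D.n D.three_le _ (ix_mem i).1 (ix_mem i).2
  have key : ∀ p q : ℕ, a + b < p + q → coord D p q x = 0 := fun p q h => hx p q (by omega)
  rw [coord_e D i a b ha hb]
  have h' : pr D (rb D.n (ix i)) < pr D (ra D.n (ix i)) := by simp only [pr]; omega
  have h1 : a = ra D.n (ix i) → coord D (rb D.n (ix i)) b x = 0 := fun h => key _ _ (by omega)
  have h2 : b = ra D.n (ix i) → coord D a (rb D.n (ix i)) x = 0 := fun h => key _ _ (by omega)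
  have h3 : a = pr D (rb D.n (ix i)) → coord D (pr D (ra D.n (ix i))) b x = 0 :=
    fun h => key _ _ (by omega)
  have h4 : b = pr D (rb D.n (ix i)) → coord D a (pr D (ra D.n (ix i))) x = 0 :=
    fun h => key _ _ (by omega)
  simp +contextual only [h1, h2, h3, h4, ite_self, mul_zero, sub_zero, add_zero]

theorem coord_eq_zero_of_notMem {a b : ℕ} (h : ¬((1 ≤ a ∧ a ≤ 2 * D.n) ∧ (1 ≤ b ∧ b ≤ 2 * D.n)))
    (x : VV D) : coord D a b x = 0 := by
  induction x using vv_induction D with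
  | tmul x y =>
    rw [coord_tm]
    by_cases ha : 1 ≤ a ∧ a ≤ 2 * D.n
    · have hb : ¬(1 ≤ b ∧ b ≤ 2 * D.n) := fun hb => h ⟨ha, hb⟩
      rw [vcoord, vcoord, dif_neg hb, LinearMap.zero_apply, mul_zero]
    · rw [vcoord, dif_neg ha, LinearMap.zero_apply, zero_mul]
  | add x y hx hy => rw [map_add, hx, hy, add_zero]

/-- The raising operators act nilpotently, so every nonzero submodule contains a nonzero vector
which they all kill. -/
theorem exists_e_smul_eq_zero {W : Submodule (U D) (VV D)} (hW : W ≠ ⊥) :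
    ∃ x ∈ W, x ≠ 0 ∧ ∀ i, U.e D i • x = 0 := by
  have key : ∀ k : ℕ, ∀ x ∈ W, x ≠ 0 → (∀ a b, k < a + b → coord D a b x = 0) →
      ∃ x ∈ W, x ≠ 0 ∧ ∀ i, U.e D i • x = 0 := by
    intro k
    induction k with
    | zero =>
      intro x _ hx h
      exact absurd (ext_coord D fun a b ha _ => by rw [h a b (by omega), map_zero]) hx
    | succ k ih =>
      intro x hxW hx h
      by_cases he : ∀ i, U.e D i • x = 0
      · exact ⟨x, hxW, hx, he⟩
      · push Not at he
        obtain ⟨i, hi⟩ := he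
        refine ih _ (W.smul_mem _ hxW) hi fun a b hab => ?_
        by_cases hr : (1 ≤ a ∧ a ≤ 2 * D.n) ∧ (1 ≤ b ∧ b ≤ 2 * D.n)
        · exact coord_e_eq_zero_of_lt D h i a b hr.1 hr.2 hab
        · exact coord_eq_zero_of_notMem D hr _
  obtain ⟨x, hxW, hx⟩ := W.exists_mem_ne_zero_of_ne_bot hW
  exact key (4 * D.n) x hxW hx fun a b hab => coord_eq_zero_of_notMem D (by omega) x

theorem cc_ne_zero : cc D ≠ 0 :=
  mul_ne_zero (inv_ne_zero (rh_ne_zero D)) (inv_ne_zero (sh_ne_zero D))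

/-- Every basis vector `v_a` of `V` with `a ≠ 1` is moved by some raising operator. If moreover
`2 < a < 2n`, it is moved by one other than `e_1`. -/
theorem exists_raising (a : ℕ) (ha : 2 ≤ a ∧ a ≤ 2 * D.n) : ∃ i : Fin D.n,
    (a = rb D.n (ix i) ∨ a = pr D (ra D.n (ix i))) ∧ (a ≠ 2 → a ≠ 2 * D.n → 2 ≤ ix i) := by
  have hn := D.three_le
  have key : ∀ i, 1 ≤ i ∧ i ≤ D.n → (a = rb D.n i ∨ a = pr D (ra D.n i)) →
      (a ≠ 2 → a ≠ 2 * D.n → 2 ≤ i) → ∃ i : Fin D.n,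
      (a = rb D.n (ix i) ∨ a = pr D (ra D.n (ix i))) ∧ (a ≠ 2 → a ≠ 2 * D.n → 2 ≤ ix i) := by
    intro i hi h1 h2
    exact ⟨gi D i hi, by rwa [ix_gi], by rwa [ix_gi]⟩
  by_cases h1 : a ≤ D.n
  · refine key (a - 1) (by omega) (Or.inl ?_) (by omega)
    unfold rb; split_ifs <;> omega
  · by_cases h2 : a ≤ D.n + 1
    · refine key D.n (by omega) (Or.inr ?_) (by omega)
      simp only [ra, lt_irrefl, if_false, pr]; omega
    · refine key (2 * D.n + 1 - a) (by omega) (Or.inr ?_) (by omega)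
      simp only [pr]; unfold ra; split_ifs <;> omega

/-- A vector killed by all raising operators is determined by its coordinates at `v_1 ⊗ v_1`,
`v_1 ⊗ v_2` and `v_1 ⊗ v_{2n}`. The columns `x_b = ∑ a, x_{ab} v_a` vanish by downward induction on
`b`: if those to the right of `x_b` do, all `e_i` kill `x_b`, so that `x_b` is a multiple of `v_1`,
and an `e_i` with `i ≠ 1` moving `v_b` detects the scalar. -/
theorem eq_zero_of_e_smul_eq_zero {x : VV D} (hx : ∀ i, U.e D i • x = 0)
    (h1 : coord D 1 1 x = 0) (h2 : coord D 1 2 x = 0) (h3 : coord D 1 (2 * D.n) x = 0) : x = 0 := by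
  have hn := D.three_le
  have hc := cc_ne_zero D
  have key : ∀ k a b : ℕ, 2 * D.n < b + k → coord D a b x = 0 := by
    intro k
    induction k with
    | zero => exact fun a b h => coord_eq_zero_of_notMem D (by omega) x
    | succ k ih =>
      intro a b hbk
      by_cases hr : (1 ≤ a ∧ a ≤ 2 * D.n) ∧ (1 ≤ b ∧ b ≤ 2 * D.n)
      swap
      · exact coord_eq_zero_of_notMem D hr x
      obtain ⟨ha, hb⟩ := hr
      have hgt : ∀ p q, b < q → coord D p q x = 0 := fun p q h => ih p q (by omega)
      by_cases ha1 : a = 1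
      · subst ha1
        by_cases hb1 : b = 1
        · rwa [hb1]
        by_cases hb2 : b = 2
        · rwa [hb2]
        by_cases hb3 : b = 2 * D.n
        · rwa [hb3]
        obtain ⟨i, hi, hi2⟩ := exists_raising D b (by omega)
        specialize hi2 hb2 hb3
        obtain ⟨m1, m2, m3, m4⟩ := ra_mem D.n D.three_le _ (ix_mem i).1 (ix_mem i).2
        have hd := diagEntry_ne_zero D.n (r_ne_zero D) (s_ne_zero D) (ix i) 1
        have n1 : (1 : ℕ) ≠ ra D.n (ix i) := by unfold ra; split_ifs <;> omega
        have n2 : (1 : ℕ) ≠ pr D (rb D.n (ix i)) := by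
          simp only [pr]; unfold rb; split_ifs <;> omega
        have n3 : ra D.n (ix i) ≠ pr D (rb D.n (ix i)) := by
          simp only [pr]; unfold ra rb; split_ifs <;> omega
        rcases hi with hi | hi
        · have h := coord_e D i 1 (ra D.n (ix i)) (by omega) (by omega) x
          rw [hx i, map_zero, if_neg n1, if_neg n2, if_pos rfl, if_neg n3, ← hi] at h
          simpa [hd] using h
        · have h := coord_e D i 1 (pr D (rb D.n (ix i))) (by omega) (by simp only [pr]; omega) x
          rw [hx i, map_zero, if_neg n1, if_neg n2, if_neg n3.symm, if_pos rfl, ← hi] at h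
          simpa [hd, hc] using h
      · obtain ⟨i, hi, -⟩ := exists_raising D a (by omega)
        obtain ⟨m1, m2, m3, m4⟩ := ra_mem D.n D.three_le _ (ix_mem i).1 (ix_mem i).2
        have hlt := ra_lt_rb D (ix i)
        have n3 : ra D.n (ix i) ≠ pr D (rb D.n (ix i)) := by
          simp only [pr]; unfold ra rb; split_ifs <;> omega
        have z1 : ∀ p, b = ra D.n (ix i) → coord D p (rb D.n (ix i)) x = 0 :=
          fun p h => hgt _ _ (by omega)
        have z2 : ∀ p, b = pr D (rb D.n (ix i)) → coord D p (pr D (ra D.n (ix i))) x = 0 :=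
          fun p h => hgt _ _ (by simp only [pr] at h ⊢; omega)
        rcases hi with hi | hi
        · have h := coord_e D i (ra D.n (ix i)) b (by omega) hb x
          rw [hx i, map_zero, if_pos rfl, if_neg n3] at h
          simp +contextual only [z1, z2, ite_self, mul_zero, sub_zero, add_zero] at h
          rw [hi, ← h]
        · have h := coord_e D i (pr D (rb D.n (ix i))) b (by simp only [pr]; omega) hb x
          rw [hx i, map_zero, if_neg n3.symm, if_pos rfl] at h
          simp +contextual only [z1, z2, ite_self, mul_zero, sub_zero, add_zero] at h
          rw [hi]
          simpa [hc] using h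
  exact ext_coord D fun a b ha hb => by rw [key (2 * D.n) a b (by omega), map_zero]

/-! ### Generators on basis vectors -/

theorem E_mulVec_v (k l a : ℕ) (hl : 1 ≤ l ∧ l ≤ 2 * D.n) :
    (E D k l).mulVec (v D a) = if a = l then v D k else 0 := by
  funext x
  have h1 : l - 1 + 1 = l := by omega
  simp only [Matrix.mulVec, dotProduct, E, Matrix.of_apply, v]
  rw [Finset.sum_eq_single (⟨l - 1, by omega⟩ : Fin (2 * D.n))]
  · simp only [h1, and_true]
    by_cases h : a = l <;> simp [h, v, eq_comm (a := l) (b := a)]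
  · intro b _ hb
    have : (b : ℕ) + 1 ≠ l := fun h => hb (Fin.ext (by simp; omega))
    simp [this]
  · simp

theorem diagonal_mulVec_v (g : ℕ → K) (a : ℕ) :
    (Matrix.diagonal fun i : Fin (2 * D.n) => g ((i : ℕ) + 1)).mulVec (v D a) = g a • v D a := by
  funext x
  simp only [Matrix.mulVec_diagonal, v, Pi.smul_apply, smul_eq_mul]
  grind

/-- The vector `e_i v_a`. -/
def eVec (i a : ℕ) : Vec D :=
  (if a = rb D.n i then v D (ra D.n i) else 0)
    - cc D • (if a = pr D (ra D.n i) then v D (pr D (rb D.n i)) else 0)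

/-- The vector `f_i v_a`. -/
def fVec (i a : ℕ) : Vec D :=
  (if a = ra D.n i then v D (rb D.n i) else 0)
    - cc D • (if a = pr D (rb D.n i) then v D (pr D (ra D.n i)) else 0)

theorem vecGen_e_mulVec (i : Fin D.n) (a : ℕ) :
    (vecGen D (.e i)).mulVec (v D a) = eVec D (ix i) a := by
  obtain ⟨m1, m2, m3, m4⟩ := ra_mem D.n D.three_le _ (ix_mem i).1 (ix_mem i).2
  rw [vecGen_e, Matrix.sub_mulVec, Matrix.smul_mulVec, E_mulVec_v D _ _ _ ⟨m3, m4⟩,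
    E_mulVec_v D _ _ _ (by simp only [pr]; omega)]
  rfl

theorem vecGen_f_mulVec (i : Fin D.n) (a : ℕ) :
    (vecGen D (.f i)).mulVec (v D a) = fVec D (ix i) a := by
  obtain ⟨m1, m2, m3, m4⟩ := ra_mem D.n D.three_le _ (ix_mem i).1 (ix_mem i).2
  rw [vecGen_f, Matrix.sub_mulVec, Matrix.smul_mulVec, E_mulVec_v D _ _ _ ⟨m1, m2⟩,
    E_mulVec_v D _ _ _ (by simp only [pr]; omega)]
  rfl

theorem tm_smul_left (c : K) (x y : Vec D) : tm D (c • x) y = c • tm D x y :=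
  (TensorProduct.smul_tmul' c x y).symm

theorem tm_smul_right (c : K) (x y : Vec D) : tm D x (c • y) = c • tm D x y :=
  TensorProduct.tmul_smul c x y

theorem tm_zero_left (y : Vec D) : tm D 0 y = 0 := TensorProduct.zero_tmul _ y

theorem tm_zero_right (x : Vec D) : tm D x 0 = 0 := TensorProduct.tmul_zero _ x

theorem tm_v (a b : ℕ) : tm D (v D a) (v D b) = vv D a b := rfl

theorem e_smul_vv (i : Fin D.n) (a b : ℕ) : U.e D i • vv D a b =
    tm D (eVec D (ix i) a) (v D b)
      + diagEntry D.n D.r D.s (ix i) a • tm D (v D a) (eVec D (ix i) b) := by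
  rw [← tm_v, e_smul_tm, vecGen_e_mulVec, vecGen_e_mulVec]
  simp only [vecGen, diagMat]
  rw [diagonal_mulVec_v, tm_smul_left]

theorem f_smul_vv (i : Fin D.n) (a b : ℕ) : U.f D i • vv D a b =
    tm D (v D a) (fVec D (ix i) b)
      + diagEntry D.n D.s D.r (ix i) b • tm D (fVec D (ix i) a) (v D b) := by
  rw [← tm_v, f_smul_tm, vecGen_f_mulVec, vecGen_f_mulVec]
  simp only [vecGen, diagMat]
  rw [diagonal_mulVec_v, tm_smul_right]

/-- The torus generators scale `v_a` by `g a`, for some `g` with `g a' = (g a)⁻¹`. -/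
theorem exists_t_smul_vv (t : Tor D.n) : ∃ g : ℕ → K,
    (∀ a b, U.t D t • vv D a b = (g a * g b) • vv D a b) ∧
    ∀ a, 1 ≤ a ∧ a ≤ 2 * D.n → g (pr D a) * g a = 1 := by
  have hr := r_ne_zero D
  have hs := s_ne_zero D
  have key : ∀ g : ℕ → K,
      vecGen D (.t t) = Matrix.diagonal (fun i : Fin (2 * D.n) => g ((i : ℕ) + 1)) →
      ∀ a b, U.t D t • vv D a b = (g a * g b) • vv D a b := by
    intro g hg a b
    rw [← tm_v, t_smul_tm, hg, diagonal_mulVec_v, diagonal_mulVec_v, tm_smul_left, tm_smul_right,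
      smul_smul]
  cases t with
  | w i =>
    refine ⟨fun a => diagEntry D.n D.r D.s (ix i) a, key _ rfl, fun a ha => ?_⟩
    dsimp only
    rw [pr, diag_pr D.n D.three_le _ _ (ix_mem i).1 (ix_mem i).2 ha.1 ha.2]
    exact inv_mul_cancel₀ (diagEntry_ne_zero D.n hr hs _ _)
  | w' i =>
    refine ⟨fun a => diagEntry D.n D.s D.r (ix i) a, key _ rfl, fun a ha => ?_⟩
    dsimp only
    rw [pr, diag_pr D.n D.three_le _ _ (ix_mem i).1 (ix_mem i).2 ha.1 ha.2]
    exact inv_mul_cancel₀ (diagEntry_ne_zero D.n hs hr _ _)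
  | wInv i =>
    refine ⟨fun a => (diagEntry D.n D.r D.s (ix i) a)⁻¹, key _ rfl, fun a ha => ?_⟩
    dsimp only
    rw [pr, diag_pr D.n D.three_le _ _ (ix_mem i).1 (ix_mem i).2 ha.1 ha.2, inv_inv]
    exact mul_inv_cancel₀ (diagEntry_ne_zero D.n hr hs _ _)
  | w'Inv i =>
    refine ⟨fun a => (diagEntry D.n D.s D.r (ix i) a)⁻¹, key _ rfl, fun a ha => ?_⟩
    dsimp only
    rw [pr, diag_pr D.n D.three_le _ _ (ix_mem i).1 (ix_mem i).2 ha.1 ha.2, inv_inv]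
    exact mul_inv_cancel₀ (diagEntry_ne_zero D.n hs hr _ _)

theorem diagEntry_ra (r s : K) (i : ℕ) (hi : 1 ≤ i ∧ i ≤ D.n) :
    diagEntry D.n r s i (ra D.n i) = r := by
  have := D.three_le
  unfold diagEntry ra
  split_ifs <;> first | rfl | omega

theorem diagEntry_rb (r s : K) (i : ℕ) (hi : 1 ≤ i ∧ i ≤ D.n) :
    diagEntry D.n r s i (rb D.n i) = s := by
  have := D.three_le
  unfold diagEntry rb
  split_ifs <;> first | rfl | omega

theorem diagEntry_pr_ra (r s : K) (i : ℕ) (hi : 1 ≤ i ∧ i ≤ D.n) :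
    diagEntry D.n r s i (pr D (ra D.n i)) = r⁻¹ := by
  obtain ⟨m1, m2, m3, m4⟩ := ra_mem D.n D.three_le _ hi.1 hi.2
  rw [pr, diag_pr D.n D.three_le _ _ hi.1 hi.2 m1 m2, diagEntry_ra D r s i hi]

theorem diagEntry_pr_rb (r s : K) (i : ℕ) (hi : 1 ≤ i ∧ i ≤ D.n) :
    diagEntry D.n r s i (pr D (rb D.n i)) = s⁻¹ := by
  obtain ⟨m1, m2, m3, m4⟩ := ra_mem D.n D.three_le _ hi.1 hi.2
  rw [pr, diag_pr D.n D.three_le _ _ hi.1 hi.2 m3 m4, diagEntry_rb D r s i hi]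

theorem pr_pr (a : ℕ) (ha : 1 ≤ a ∧ a ≤ 2 * D.n) : pr D (pr D a) = a := by
  simp only [pr]; omega

/-! ### The three singular vectors -/

theorem isSingular_vv : IsSingular D (vv D 1 1) where
  e_smul i := by
    have hn := D.three_le
    have hi := ix_mem i
    have h1 : (1 : ℕ) ≠ rb D.n (ix i) := by unfold rb; split_ifs <;> omega
    have h2 : (1 : ℕ) ≠ pr D (ra D.n (ix i)) := by
      simp only [pr]; unfold ra; split_ifs <;> omega
    have h : eVec D (ix i) 1 = 0 := by
      rw [eVec, if_neg h1, if_neg h2, smul_zero, sub_zero]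
    rw [e_smul_vv, h, tm_zero_left, tm_zero_right, smul_zero, add_zero]
  t_smul a := by
    obtain ⟨g, hg, -⟩ := exists_t_smul_vv D a
    exact ⟨_, hg 1 1⟩

theorem isSingular_alt : IsSingular D (vv D 1 2 - D.r • vv D 2 1) where
  e_smul i := by
    have hn := D.three_le
    have hi := ix_mem i
    have h1 : (1 : ℕ) ≠ rb D.n (ix i) := by unfold rb; split_ifs <;> omega
    have h2 : (1 : ℕ) ≠ pr D (ra D.n (ix i)) := by
      simp only [pr]; unfold ra; split_ifs <;> omega
    have h3 : (2 : ℕ) ≠ pr D (ra D.n (ix i)) := by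
      simp only [pr]; unfold ra; split_ifs <;> omega
    have h : eVec D (ix i) 1 = 0 := by
      rw [eVec, if_neg h1, if_neg h2, smul_zero, sub_zero]
    rw [smul_sub, smul_comm, e_smul_vv, e_smul_vv, h, tm_zero_left, tm_zero_right, smul_zero,
      add_zero, zero_add]
    by_cases h4 : ix i = 1
    · have ha : ra D.n (ix i) = 1 := by rw [h4, ra, if_pos (by omega)]
      have hb : rb D.n (ix i) = 2 := by rw [h4, rb, if_pos (by omega)]
      have h' : eVec D (ix i) 2 = v D 1 := by
        rw [eVec, if_pos hb.symm, if_neg h3, smul_zero, sub_zero, ha]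
      have hd := diagEntry_ra D D.r D.s (ix i) hi
      rw [ha] at hd
      rw [h', hd, sub_self]
    · have hb : (2 : ℕ) ≠ rb D.n (ix i) := by unfold rb; split_ifs <;> omega
      have h' : eVec D (ix i) 2 = 0 := by
        rw [eVec, if_neg hb, if_neg h3, smul_zero, sub_zero]
      rw [h', tm_zero_left, tm_zero_right, smul_zero, smul_zero, sub_zero]
  t_smul a := by
    obtain ⟨g, hg, -⟩ := exists_t_smul_vv D a
    refine ⟨g 1 * g 2, ?_⟩
    rw [smul_sub, smul_comm, hg, hg, smul_sub, mul_comm (g 2), smul_comm D.r]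

theorem coord_omega (a b : ℕ) (ha : 1 ≤ a ∧ a ≤ 2 * D.n) (hb : 1 ≤ b ∧ b ≤ 2 * D.n) :
    coord D a b (omega D) = if a = pr D b then aCoef D b else 0 := by
  rw [omega, map_sum, Finset.sum_eq_single b]
  · rw [map_smul, coord_vv D _ _ _ _ ha hb, smul_eq_mul]
    simp
  · intro k _ hk
    rw [map_smul, coord_vv D _ _ _ _ ha hb, if_neg (fun h => hk h.2.symm), smul_zero]
  · exact fun h => absurd (Finset.mem_Icc.2 hb) h

theorem aCoef_ne_zero (a : ℕ) : aCoef D a ≠ 0 :=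
  zpow_ne_zero _ (mul_ne_zero (rh_ne_zero D) (inv_ne_zero (sh_ne_zero D)))

theorem aCoef_pr (a : ℕ) (ha : 1 ≤ a ∧ a ≤ 2 * D.n) : aCoef D (pr D a) = (aCoef D a)⁻¹ := by
  rw [aCoef, aCoef, ← zpow_neg]
  congr 1
  simp only [pr]
  unfold aExp
  split_ifs <;> omega

theorem aCoef_ra (i : ℕ) (hi : 1 ≤ i ∧ i ≤ D.n) :
    aCoef D (ra D.n i) = D.rh * D.sh⁻¹ * aCoef D (rb D.n i) := by
  have hn := D.three_le
  rw [aCoef, aCoef, ← zpow_one_add₀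
    (mul_ne_zero (rh_ne_zero D) (inv_ne_zero (sh_ne_zero D)))]
  congr 1
  unfold aExp ra rb
  split_ifs <;> omega

theorem cc_mul_r : cc D * D.r = D.rh * D.sh⁻¹ := by
  have := rh_ne_zero D
  rw [cc, ← D.rh_sq]
  field_simp

theorem e_smul_omega (i : Fin D.n) : U.e D i • omega D = 0 := by
  have hi := ix_mem i
  obtain ⟨m1, m2, m3, m4⟩ := ra_mem D.n D.three_le _ hi.1 hi.2
  have hr := r_ne_zero D
  have hs := s_ne_zero D
  have hrh := rh_ne_zero D
  have hsh := sh_ne_zero D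
  have hα := aCoef_ra D (ix i) hi
  have hz := aCoef_ne_zero D (rb D.n (ix i))
  have h1 := diagEntry_ra D D.r D.s (ix i) hi
  have h2 := diagEntry_pr_rb D D.r D.s (ix i) hi
  refine ext_coord D fun a b ha hb => ?_
  have p1 := aCoef_pr D _ ⟨m1, m2⟩
  have p2 := aCoef_pr D _ ⟨m3, m4⟩
  rw [coord_e D i a b ha hb, coord_omega D _ _ ⟨m3, m4⟩ hb, coord_omega D _ _ ha ⟨m3, m4⟩,
    coord_omega D _ _ (by simp only [pr]; omega) hb,
    coord_omega D _ _ ha (by simp only [pr]; omega), map_zero]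
  have e1 : rb D.n (ix i) = pr D b ↔ b = pr D (rb D.n (ix i)) := by simp only [pr]; omega
  have e2 : pr D (ra D.n (ix i)) = pr D b ↔ b = ra D.n (ix i) := by simp only [pr]; omega
  rw [pr_pr D _ ⟨m1, m2⟩]
  simp only [e1, e2]
  have n3 : ra D.n (ix i) ≠ pr D (rb D.n (ix i)) := by
    have := D.three_le
    simp only [pr]; unfold ra rb; split_ifs <;> omega
  have c1 : aCoef D (pr D (rb D.n (ix i)))
      = D.r * cc D * aCoef D (pr D (ra D.n (ix i))) := by
    rw [mul_comm D.r, cc_mul_r, p1, p2, hα]; field_simp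
  have c2 : cc D * aCoef D (ra D.n (ix i)) = D.s⁻¹ * aCoef D (rb D.n (ix i)) := by
    rw [hα, cc, ← D.sh_sq]; field_simp
  grind

theorem t_smul_omega (a : Tor D.n) : U.t D a • omega D = omega D := by
  obtain ⟨g, hg, hg'⟩ := exists_t_smul_vv D a
  rw [omega, Finset.smul_sum]
  refine Finset.sum_congr rfl fun k hk => ?_
  rw [smul_comm, hg, hg' k (Finset.mem_Icc.1 hk), one_smul]

theorem isSingular_omega : IsSingular D (omega D) where
  e_smul := e_smul_omega D
  t_smul a := ⟨1, by rw [one_smul, t_smul_omega]⟩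

/-! ### The dual singular functionals -/

/-- The `U`-invariant functional on `V ⊗ V`, whose value at `ω` is the quantum dimension of `V`. -/
def trace : VV D →ₗ[K] K :=
  ∑ a ∈ Finset.Icc 1 (2 * D.n), (aCoef D a)⁻¹ • coord D a (pr D a)

theorem trace_apply (x : VV D) : trace D x =
    ∑ a ∈ Finset.Icc 1 (2 * D.n), (aCoef D a)⁻¹ * coord D a (pr D a) x := by
  simp [trace, LinearMap.sum_apply]

theorem trace_f_smul (i : Fin D.n) (x : VV D) : trace D (U.f D i • x) = 0 := by
  have hi := ix_mem i
  obtain ⟨m1, m2, m3, m4⟩ := ra_mem D.n D.three_le _ hi.1 hi.2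
  have hr := r_ne_zero D
  have hs := s_ne_zero D
  have hrh := rh_ne_zero D
  have hsh := sh_ne_zero D
  have hα := aCoef_ra D (ix i) hi
  have hz := aCoef_ne_zero D (rb D.n (ix i))
  have h1 := diagEntry_ra D D.s D.r (ix i) hi
  have h2 := diagEntry_pr_rb D D.s D.r (ix i) hi
  have p1 := aCoef_pr D _ ⟨m1, m2⟩
  have p2 := aCoef_pr D _ ⟨m3, m4⟩
  have q1 := pr_pr D _ ⟨m1, m2⟩
  have q2 := pr_pr D _ ⟨m3, m4⟩
  rw [trace_apply]
  have key : ∀ a ∈ Finset.Icc 1 (2 * D.n), (aCoef D a)⁻¹ * coord D a (pr D a) (U.f D i • x) =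
      (if a = pr D (rb D.n (ix i)) then
        (aCoef D a)⁻¹ * coord D (pr D (rb D.n (ix i))) (ra D.n (ix i)) x else 0)
      - (if a = ra D.n (ix i) then
        (aCoef D a)⁻¹ * (cc D * coord D (ra D.n (ix i)) (pr D (rb D.n (ix i))) x) else 0)
      + (if a = rb D.n (ix i) then
        (aCoef D a)⁻¹ * (D.r⁻¹ * coord D (ra D.n (ix i)) (pr D (rb D.n (ix i))) x) else 0)
      - (if a = pr D (ra D.n (ix i)) then
        (aCoef D a)⁻¹ * (D.s * cc D * coord D (pr D (rb D.n (ix i))) (ra D.n (ix i)) x)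
          else 0) := by
    intro a ha
    rw [Finset.mem_Icc] at ha
    rw [coord_f D i a (pr D a) ha (by simp only [pr]; omega)]
    have e1 : pr D a = rb D.n (ix i) ↔ a = pr D (rb D.n (ix i)) := by simp only [pr]; omega
    have e2 : pr D a = pr D (ra D.n (ix i)) ↔ a = ra D.n (ix i) := by simp only [pr]; omega
    simp only [e1, e2]
    grind
  rw [Finset.sum_congr rfl key]
  simp only [Finset.sum_sub_distrib, Finset.sum_add_distrib, Finset.sum_ite_eq']
  have r1 : 1 ≤ pr D (ra D.n (ix i)) ∧ pr D (ra D.n (ix i)) ≤ 2 * D.n := by simp only [pr]; omega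
  have r2 : 1 ≤ pr D (rb D.n (ix i)) ∧ pr D (rb D.n (ix i)) ≤ 2 * D.n := by simp only [pr]; omega
  rw [if_pos (Finset.mem_Icc.2 r2), if_pos (Finset.mem_Icc.2 ⟨m1, m2⟩),
    if_pos (Finset.mem_Icc.2 ⟨m3, m4⟩), if_pos (Finset.mem_Icc.2 r1), p1, p2, hα, cc, ← D.rh_sq,
    ← D.sh_sq]
  field_simp
  ring

/-- A rational polynomial in two variables whose coefficients have nonzero sum does not vanish at
`(r, s)`. -/
theorem aeval_ne_zero (P : MvPolynomial (Fin 2) ℚ) (h : MvPolynomial.eval (fun _ => 1) P ≠ 0) :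
    MvPolynomial.aeval ![D.r, D.s] P ≠ 0 := by
  intro h0
  have := algebraicIndependent_iff.1 D.indep P h0
  exact h (by rw [this, map_zero])

theorem r_add_s_ne_zero : D.r + D.s ≠ 0 := by
  have h := aeval_ne_zero D (MvPolynomial.X 0 + MvPolynomial.X 1) (by norm_num)
  simpa using h

/-- The quantum dimension of `V` does not vanish, being the value at `(r, s)` of a Laurent
polynomial with positive value at `(1, 1)`. -/
theorem sum_aCoef_ne_zero :
    ∑ a ∈ Finset.Icc 1 (2 * D.n), (aCoef D a)⁻¹ * (aCoef D a)⁻¹ ≠ 0 := by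
  have hn := D.three_le
  have hr := r_ne_zero D
  have hs := s_ne_zero D
  have h := aeval_ne_zero D (∑ a ∈ Finset.Icc 1 (2 * D.n),
    MvPolynomial.X 0 ^ ((D.n : ℤ) - aExp D.n a).toNat
      * MvPolynomial.X 1 ^ ((D.n : ℤ) + aExp D.n a).toNat) (by
        simp only [map_sum, map_mul, map_pow, MvPolynomial.eval_X, one_pow, mul_one,
          Finset.sum_const, Nat.card_Icc, nsmul_eq_mul]
        norm_cast
        omega)
  intro h0
  apply h
  have : ∀ a ∈ Finset.Icc 1 (2 * D.n), D.r ^ ((D.n : ℤ) - aExp D.n a).toNat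
      * D.s ^ ((D.n : ℤ) + aExp D.n a).toNat
      = (D.r * D.s) ^ D.n * ((aCoef D a)⁻¹ * (aCoef D a)⁻¹) := by
    intro a ha
    rw [Finset.mem_Icc] at ha
    have b1 : 0 ≤ (D.n : ℤ) - aExp D.n a := by unfold aExp; split_ifs <;> omega
    have b2 : 0 ≤ (D.n : ℤ) + aExp D.n a := by unfold aExp; split_ifs <;> omega
    have hq : (aCoef D a)⁻¹ * (aCoef D a)⁻¹ = D.r ^ (-aExp D.n a) * D.s ^ aExp D.n a := by
      rw [aCoef, ← mul_inv, ← mul_zpow]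
      have : D.rh * D.sh⁻¹ * (D.rh * D.sh⁻¹) = D.r * D.s⁻¹ := by
        rw [← D.rh_sq, ← D.sh_sq]; ring
      rw [this, mul_zpow, mul_inv, zpow_neg, inv_zpow, inv_inv]
    rw [hq, ← zpow_natCast, ← zpow_natCast D.s, Int.toNat_of_nonneg b1, Int.toNat_of_nonneg b2,
      sub_eq_add_neg, zpow_add₀ hr, zpow_add₀ hs, zpow_natCast, zpow_natCast]
    ring
  simp only [map_sum, map_mul, map_pow, MvPolynomial.aeval_X, Matrix.cons_val_zero,
    Matrix.cons_val_one]
  rw [Finset.sum_congr rfl this, ← Finset.mul_sum, h0, mul_zero]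

theorem trace_omega : trace D (omega D) ≠ 0 := by
  rw [trace_apply]
  refine ne_of_eq_of_ne (Finset.sum_congr rfl fun a ha => ?_) (sum_aCoef_ne_zero D)
  rw [Finset.mem_Icc] at ha
  rw [coord_omega D _ _ ha (by simp only [pr]; omega), pr_pr D a ha, if_pos rfl, aCoef_pr D a ha]

theorem trace_vv (a b : ℕ) (ha : 1 ≤ a ∧ a ≤ 2 * D.n) :
    trace D (vv D a b) = if b = pr D a then (aCoef D a)⁻¹ else 0 := by
  rw [trace_apply, Finset.sum_eq_single a]
  · rw [coord_vv D _ _ _ _ ha (by simp only [pr]; omega)]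
    simp [eq_comm]
  · intro k hk hka
    rw [Finset.mem_Icc] at hk
    rw [coord_vv D _ _ _ _ hk (by simp only [pr]; omega), if_neg (fun h => hka h.1), mul_zero]
  · exact fun h => absurd (Finset.mem_Icc.2 ha) h

theorem coord_one_one_f_smul (i : Fin D.n) (x : VV D) : coord D 1 1 (U.f D i • x) = 0 := by
  have hn := D.three_le
  have hi := ix_mem i
  have h1 : (1 : ℕ) ≠ rb D.n (ix i) := by unfold rb; split_ifs <;> omega
  have h2 : (1 : ℕ) ≠ pr D (ra D.n (ix i)) := by
    simp only [pr]; unfold ra; split_ifs <;> omega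
  rw [coord_f D i 1 1 (by omega) (by omega), if_neg h1, if_neg h2, if_neg h1, if_neg h2]
  ring

/-- The functional taking `v_1 ⊗ v_2` to `s` and `v_2 ⊗ v_1` to `-1`. -/
def altFunctional : VV D →ₗ[K] K := D.s • coord D 1 2 - coord D 2 1

theorem altFunctional_f_smul (i : Fin D.n) (x : VV D) : altFunctional D (U.f D i • x) = 0 := by
  have hn := D.three_le
  have hi := ix_mem i
  have h1 : (1 : ℕ) ≠ rb D.n (ix i) := by unfold rb; split_ifs <;> omega
  have h2 : (1 : ℕ) ≠ pr D (ra D.n (ix i)) := by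
    simp only [pr]; unfold ra; split_ifs <;> omega
  have h3 : (2 : ℕ) ≠ pr D (ra D.n (ix i)) := by
    simp only [pr]; unfold ra; split_ifs <;> omega
  rw [altFunctional, LinearMap.sub_apply, LinearMap.smul_apply, smul_eq_mul,
    coord_f D i 1 2 (by omega) (by omega), coord_f D i 2 1 (by omega) (by omega),
    if_neg h1, if_neg h2, if_neg h3, if_neg h1, if_neg h2, if_neg h3]
  by_cases h4 : ix i = 1
  · have ha : ra D.n (ix i) = 1 := by rw [h4, ra, if_pos (by omega)]
    have hb : rb D.n (ix i) = 2 := by rw [h4, rb, if_pos (by omega)]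
    have hd := diagEntry_ra D D.s D.r (ix i) hi
    rw [ha] at hd
    rw [hd, hb, ha]
    simp
  · have hb : (2 : ℕ) ≠ rb D.n (ix i) := by unfold rb; split_ifs <;> omega
    rw [if_neg hb, if_neg hb]
    ring

/-! ### Simplicity and independence -/

/-- The three singular vectors of `V ⊗ V`. -/
def hw : Fin 3 → VV D := ![omega D, vv D 1 1, vv D 1 2 - D.r • vv D 2 1]

/-- Functionals vanishing on the images of all `f_i`, dual to the singular vectors up to nonzero
factors. -/
def hwDual : Fin 3 → VV D →ₗ[K] K := ![trace D, coord D 1 1, altFunctional D]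

theorem isSingular_hw (k : Fin 3) : IsSingular D (hw D k) := by
  fin_cases k
  exacts [isSingular_omega D, isSingular_vv D, isSingular_alt D]

theorem hwDual_f_smul (k : Fin 3) (i : Fin D.n) (x : VV D) : hwDual D k (U.f D i • x) = 0 := by
  fin_cases k
  exacts [trace_f_smul D i x, coord_one_one_f_smul D i x, altFunctional_f_smul D i x]

theorem hwDual_hw_ne_zero (k : Fin 3) : hwDual D k (hw D k) ≠ 0 := by
  have hn := D.three_le
  fin_cases k
  · exact trace_omega D
  · change coord D 1 1 (vv D 1 1) ≠ 0
    rw [coord_vv D _ _ _ _ (by omega) (by omega)]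
    simp
  · change altFunctional D (vv D 1 2 - D.r • vv D 2 1) ≠ 0
    simp only [altFunctional, LinearMap.sub_apply, LinearMap.smul_apply, map_sub, map_smul,
      smul_eq_mul, coord_vv D 1 2 _ _ (by omega : 1 ≤ 1 ∧ 1 ≤ 2 * D.n)
        (by omega : 1 ≤ 2 ∧ 2 ≤ 2 * D.n), coord_vv D 2 1 _ _ (by omega : 1 ≤ 2 ∧ 2 ≤ 2 * D.n)
        (by omega : 1 ≤ 1 ∧ 1 ≤ 2 * D.n)]
    have := r_add_s_ne_zero D
    simpa [add_comm] using this

theorem hwDual_hw_of_ne {k l : Fin 3} (h : k ≠ l) : hwDual D k (hw D l) = 0 := by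
  have hn := D.three_le
  have i1 : 1 ≤ 1 ∧ 1 ≤ 2 * D.n := by omega
  have i2 : 1 ≤ 2 ∧ 2 ≤ 2 * D.n := by omega
  have n1 : 1 ≠ pr D 1 := by simp only [pr]; omega
  have n2 : 1 ≠ pr D 2 := by simp only [pr]; omega
  have n3 : 2 ≠ pr D 1 := by simp only [pr]; omega
  fin_cases k <;> fin_cases l <;> first | exact absurd rfl h | skip
  · change trace D (vv D 1 1) = 0
    rw [trace_vv D _ _ i1, if_neg n1]
  · change trace D (vv D 1 2 - D.r • vv D 2 1) = 0
    rw [map_sub, map_smul, trace_vv D _ _ i1, trace_vv D _ _ i2, if_neg n3, if_neg n2]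
    simp
  · change coord D 1 1 (omega D) = 0
    rw [coord_omega D _ _ i1 i1, if_neg n1]
  · change coord D 1 1 (vv D 1 2 - D.r • vv D 2 1) = 0
    rw [map_sub, map_smul, coord_vv D _ _ _ _ i1 i1, coord_vv D _ _ _ _ i1 i1]
    simp
  · change altFunctional D (omega D) = 0
    rw [altFunctional, LinearMap.sub_apply, LinearMap.smul_apply, coord_omega D _ _ i1 i2,
      coord_omega D _ _ i2 i1, if_neg n2, if_neg n3]
    simp
  · change altFunctional D (vv D 1 1) = 0
    rw [altFunctional, LinearMap.sub_apply, LinearMap.smul_apply, coord_vv D _ _ _ _ i1 i2,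
      coord_vv D _ _ _ _ i2 i1]
    simp

theorem eq_sum_hw {x : VV D} (hx : ∀ i, U.e D i • x = 0) : ∃ c : Fin 3 → K,
    x = ∑ k, c k • hw D k := by
  have hn := D.three_le
  have i1 : 1 ≤ 1 ∧ 1 ≤ 2 * D.n := by omega
  have i2 : 1 ≤ 2 ∧ 2 ≤ 2 * D.n := by omega
  have i3 : 1 ≤ 2 * D.n ∧ 2 * D.n ≤ 2 * D.n := by omega
  have n1 : 1 ≠ pr D 1 := by simp only [pr]; omega
  have n2 : 1 ≠ pr D 2 := by simp only [pr]; omega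
  have n3 : 1 = pr D (2 * D.n) := by simp only [pr]; omega
  have n4 : 2 * D.n ≠ 1 := by omega
  have n5 : 2 * D.n ≠ 2 := by omega
  have hz := aCoef_ne_zero D (2 * D.n)
  refine ⟨![coord D 1 (2 * D.n) x * (aCoef D (2 * D.n))⁻¹, coord D 1 1 x, coord D 1 2 x], ?_⟩
  rw [← sub_eq_zero]
  refine eq_zero_of_e_smul_eq_zero D (fun i => ?_) ?_ ?_ ?_
  · rw [smul_sub, hx i, Finset.smul_sum, zero_sub, neg_eq_zero]
    exact Finset.sum_eq_zero fun k _ => by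
      rw [smul_comm, (isSingular_hw D k).e_smul, smul_zero]
  all_goals
    simp only [Fin.sum_univ_three, hw, Matrix.cons_val_zero, Matrix.cons_val_one, Matrix.cons_val,
      map_sub, map_add, map_smul, smul_eq_mul, coord_omega D _ _ i1 i1, coord_omega D _ _ i1 i2,
      coord_omega D _ _ i1 i3, coord_vv D _ _ _ _ i1 i1, coord_vv D _ _ _ _ i1 i2,
      coord_vv D _ _ _ _ i1 i3, if_neg n1, if_neg n2, if_pos n3, n4, n5, and_false, if_false]
    simp [hz]

theorem hwDual_eq_zero {k l : Fin 3} (h : k ≠ l) {x : VV D}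
    (hx : x ∈ Submodule.span (U D) {hw D l}) : hwDual D k x = 0 :=
  (isSingular_hw D l).apply_eq_zero (hwDual_hw_of_ne D h) (hwDual_f_smul D k) hx

/-- A nonzero submodule of the one generated by a singular vector contains a multiple of it, as the
dual functionals exclude the other singular vectors. -/
theorem isAtom_span_hw (k : Fin 3) : IsAtom (Submodule.span (U D) {hw D k}) := by
  have hne : hw D k ≠ 0 := fun h => hwDual_hw_ne_zero D k (by rw [h, map_zero])
  refine isAtom_iff_le_of_ge.2 ⟨?_, fun W hW hWk => ?_⟩
  · rwa [Ne, Submodule.span_singleton_eq_bot]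
  · obtain ⟨x, hxW, hx0, hx⟩ := exists_e_smul_eq_zero D hW
    obtain ⟨c, hc⟩ := eq_sum_hw D hx
    have hcl : ∀ l, l ≠ k → c l = 0 := by
      intro l hl
      have h := hwDual_eq_zero D hl (hWk hxW)
      rw [hc, map_sum, Finset.sum_eq_single l, map_smul, smul_eq_mul] at h
      · exact (mul_eq_zero.1 h).resolve_right (hwDual_hw_ne_zero D l)
      · intro m _ hm
        rw [map_smul, hwDual_hw_of_ne D hm.symm, smul_zero]
      · exact fun h => absurd (Finset.mem_univ _) h
    rw [Finset.sum_eq_single k (fun l _ hl => by rw [hcl l hl, zero_smul])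
      (fun h => absurd (Finset.mem_univ _) h)] at hc
    have hck : c k ≠ 0 := fun h => hx0 (by rw [hc, h, zero_smul])
    rw [Submodule.span_singleton_le_iff_mem]
    have : hw D k = (c k)⁻¹ • x := by rw [hc, smul_smul, inv_mul_cancel₀ hck, one_smul]
    rw [this]
    exact Submodule.smul_of_tower_mem W _ hxW

theorem iSupIndep_span_hw : iSupIndep fun k => Submodule.span (U D) {hw D k} := by
  intro k
  refine (isAtom_span_hw D k).not_le_iff_disjoint.1 fun h => ?_
  have hker : ∀ x ∈ ⨆ j, ⨆ (_ : j ≠ k), Submodule.span (U D) {hw D j}, hwDual D k x = 0 := by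
    intro x hx
    induction hx using Submodule.iSup_induction' with
    | mem j x hx =>
      by_cases hj : j = k
      · rw [iSup_neg (by simpa using hj), Submodule.mem_bot] at hx
        rw [hx, map_zero]
      · rw [iSup_pos hj] at hx
        exact hwDual_eq_zero D (Ne.symm hj) hx
    | zero => exact map_zero _
    | add x y _ _ hx hy => rw [map_add, hx, hy, add_zero]
  exact hwDual_hw_ne_zero D k (hker _ (h (Submodule.mem_span_singleton_self _)))

/-! ### Generation from the highest weight vectors -/

/-- `v_a ⊗ v_b + κ v_b ⊗ v_a`. -/
def twist (κ : K) (a b : ℕ) : VV D := vv D a b + κ • vv D b a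

/-- `f_i` maps `v_b` to a nonzero multiple of `v_c`. -/
def Arrow (i b c : ℕ) : Prop :=
  (b = ra D.n i ∧ c = rb D.n i) ∨ (b = pr D (rb D.n i) ∧ c = pr D (ra D.n i))

/-- `f_i` kills `v_a`. -/
def Killed (i a : ℕ) : Prop := a ≠ ra D.n i ∧ a ≠ pr D (rb D.n i)

variable {D}

theorem Killed.fVec_eq_zero {i a : ℕ} (h : Killed D i a) : fVec D i a = 0 := by
  rw [fVec, if_neg h.1, if_neg h.2, smul_zero, sub_zero]

theorem Arrow.killed {i b c : ℕ} (h : Arrow D i b c) (hi : 1 ≤ i ∧ i ≤ D.n) : Killed D i c := by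
  have := D.three_le
  unfold Arrow Killed at *
  simp only [pr] at *
  unfold ra rb at *
  split_ifs at * <;> omega

theorem fVec_ra (i : ℕ) (hi : 1 ≤ i ∧ i ≤ D.n) : fVec D i (ra D.n i) = v D (rb D.n i) := by
  have := D.three_le
  have h : ra D.n i ≠ pr D (rb D.n i) := by
    simp only [pr]; unfold ra rb; split_ifs <;> omega
  rw [fVec, if_pos rfl, if_neg h, smul_zero, sub_zero]

theorem fVec_pr_rb (i : ℕ) (hi : 1 ≤ i ∧ i ≤ D.n) :
    fVec D i (pr D (rb D.n i)) = (-cc D) • v D (pr D (ra D.n i)) := by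
  have := D.three_le
  have h : pr D (rb D.n i) ≠ ra D.n i := by
    simp only [pr]; unfold ra rb; split_ifs <;> omega
  rw [fVec, if_neg h, if_pos rfl, zero_sub, neg_smul]

theorem Arrow.exists_fVec_eq {i b c : ℕ} (h : Arrow D i b c) (hi : 1 ≤ i ∧ i ≤ D.n) :
    ∃ d : K, d ≠ 0 ∧ fVec D i b = d • v D c := by
  rcases h with ⟨rfl, rfl⟩ | ⟨rfl, rfl⟩
  · exact ⟨1, one_ne_zero, by rw [fVec_ra i hi, one_smul]⟩
  · exact ⟨_, neg_ne_zero.2 (cc_ne_zero D), fVec_pr_rb i hi⟩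

theorem f_gi_smul_vv (i : ℕ) (hi : 1 ≤ i ∧ i ≤ D.n) (a b : ℕ) : U.f D (gi D i hi) • vv D a b =
    tm D (v D a) (fVec D i b) + diagEntry D.n D.s D.r i b • tm D (fVec D i a) (v D b) := by
  rw [f_smul_vv, ix_gi]

variable {N : Submodule (U D) (VV D)}

theorem mem_of_smul_mem {c : K} (hc : c ≠ 0) {x : VV D} (h : c • x ∈ N) : x ∈ N := by
  have := Submodule.smul_of_tower_mem N c⁻¹ h
  rwa [smul_smul, inv_mul_cancel₀ hc, one_smul] at this

/-- Lowering the second index. -/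
theorem twist_mem_right {i a b c : ℕ} {κ : K} (hi : 1 ≤ i ∧ i ≤ D.n) (hbc : Arrow D i b c)
    (ha : Killed D i a) (h : twist D κ a b ∈ N) :
    twist D (κ * diagEntry D.n D.s D.r i a) a c ∈ N := by
  obtain ⟨d, hd, hb⟩ := hbc.exists_fVec_eq hi
  refine mem_of_smul_mem hd ?_
  have h' := N.smul_mem (U.f D (gi D i hi)) h
  rw [twist, smul_add, smul_comm, f_gi_smul_vv, f_gi_smul_vv, ha.fVec_eq_zero, hb, tm_zero_left,
    tm_zero_right, smul_zero, add_zero, zero_add, tm_smul_left, tm_smul_right, tm_v, tm_v] at h'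
  convert h' using 1
  rw [twist]
  module

/-- Lowering the first index. -/
theorem twist_mem_left {i a b c : ℕ} {κ : K} (hi : 1 ≤ i ∧ i ≤ D.n) (hac : Arrow D i a c)
    (hb : Killed D i b) (h : twist D κ a b ∈ N) :
    twist D (κ * (diagEntry D.n D.s D.r i b)⁻¹) c b ∈ N := by
  obtain ⟨d, hd, ha⟩ := hac.exists_fVec_eq hi
  have hz := diagEntry_ne_zero D.n (s_ne_zero D) (r_ne_zero D) i b
  refine mem_of_smul_mem (mul_ne_zero hz hd) ?_
  have h' := N.smul_mem (U.f D (gi D i hi)) h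
  rw [twist, smul_add, smul_comm, f_gi_smul_vv, f_gi_smul_vv, hb.fVec_eq_zero, ha, tm_zero_left,
    tm_zero_right, smul_zero, add_zero, zero_add, tm_smul_left, tm_smul_right, tm_v, tm_v] at h'
  convert h' using 1
  rw [twist, smul_add, smul_smul, smul_smul, smul_smul]
  congr 2
  field_simp

theorem U_smul_smul (u : U D) (c : K) (x : VV D) : u • c • x = c • u • x := smul_comm u c x

theorem f_sq_smul_vv {i a b c d : ℕ} {p q : K} (hi : 1 ≤ i ∧ i ≤ D.n)
    (ha : fVec D i a = p • v D c) (hb : fVec D i b = q • v D d)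
    (hc : Killed D i c) (hd : Killed D i d) :
    U.f D (gi D i hi) • U.f D (gi D i hi) • vv D a b =
      (p * q * (diagEntry D.n D.s D.r i d + diagEntry D.n D.s D.r i b)) • vv D c d := by
  rw [f_gi_smul_vv, ha, hb, tm_smul_left, tm_smul_right, tm_v, tm_v, smul_add, U_smul_smul,
    U_smul_smul, U_smul_smul, f_gi_smul_vv, f_gi_smul_vv, ha, hb, hc.fVec_eq_zero, hd.fVec_eq_zero,
    tm_zero_left, tm_zero_right, tm_smul_left, tm_smul_right, tm_v]
  module

/-- Lowering both indices with the same `f_i`. -/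
theorem twist_mem_sq {i a b c d : ℕ} {κ : K} (hi : 1 ≤ i ∧ i ≤ D.n) (hac : Arrow D i a c)
    (hbd : Arrow D i b d)
    (hz : diagEntry D.n D.s D.r i d + diagEntry D.n D.s D.r i b ≠ 0) (h : twist D κ a b ∈ N) :
    twist D (κ * (diagEntry D.n D.s D.r i c + diagEntry D.n D.s D.r i a)
      * (diagEntry D.n D.s D.r i d + diagEntry D.n D.s D.r i b)⁻¹) c d ∈ N := by
  obtain ⟨p, hp, ha⟩ := hac.exists_fVec_eq hi
  obtain ⟨q, hq, hb⟩ := hbd.exists_fVec_eq hi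
  refine mem_of_smul_mem (mul_ne_zero (mul_ne_zero hp hq) hz) ?_
  have h' := N.smul_mem (U.f D (gi D i hi)) (N.smul_mem (U.f D (gi D i hi)) h)
  rw [twist, smul_add, smul_add, U_smul_smul, U_smul_smul,
    f_sq_smul_vv hi ha hb (hac.killed hi) (hbd.killed hi),
    f_sq_smul_vv hi hb ha (hbd.killed hi) (hac.killed hi)] at h'
  convert h' using 1
  rw [twist, smul_add, smul_smul, smul_smul]
  congr 2
  field_simp

variable (D)

theorem r_inv_add_s_inv_ne_zero : D.r⁻¹ + D.s⁻¹ ≠ 0 := by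
  have hr := r_ne_zero D
  have hs := s_ne_zero D
  have : D.r⁻¹ + D.s⁻¹ = (D.r + D.s) * (D.r⁻¹ * D.s⁻¹) := by field_simp; ring
  rw [this]
  exact mul_ne_zero (r_add_s_ne_zero D) (by positivity)

/-- The coefficient `κ` of the listed vectors `v_a ⊗ v_b + κ v_b ⊗ v_a` for `a < b < a'`, in terms of
its value `q` on the pairs of the first family; `q` is `s` for `S'` and `-r` for `Λ`. The
coefficient for a pair `(a, m')` with `m < a < m'` is `kap D q a`. -/
def kap (q : K) (b : ℕ) : K := if b ≤ D.n then q else q * (D.s⁻¹ * D.r⁻¹)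

variable {D}

theorem arrow_low (a : ℕ) (h : 1 ≤ a ∧ a < D.n) : Arrow D a a (a + 1) :=
  Or.inl ⟨by rw [ra, if_pos h.2], by rw [rb, if_pos h.2]⟩

theorem arrow_high (a : ℕ) (h : D.n + 1 ≤ a ∧ a < 2 * D.n) : Arrow D (2 * D.n - a) a (a + 1) :=
  Or.inr ⟨by rw [rb, if_pos (by omega)]; simp only [pr]; omega,
    by rw [ra, if_pos (by omega)]; simp only [pr]; omega⟩

theorem arrow_last : Arrow D D.n (D.n - 1) (D.n + 1) :=
  Or.inr ⟨by rw [rb, if_neg (by omega)]; simp only [pr]; omega,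
    by rw [ra, if_neg (by omega)]; simp only [pr]; omega⟩

theorem arrow_last' : Arrow D D.n D.n (D.n + 2) :=
  Or.inl ⟨by rw [ra, if_neg (by omega)], by rw [rb, if_neg (by omega)]⟩

theorem killed_of_lt {i a : ℕ} (hi : i < D.n) (h : a ≠ i ∧ a ≠ 2 * D.n - i) : Killed D i a := by
  rw [Killed, ra, rb, if_pos hi, if_pos hi]
  refine ⟨h.1, ?_⟩
  simp only [pr]
  omega

theorem killed_last {a : ℕ} (h : a ≠ D.n ∧ a ≠ D.n - 1) : Killed D D.n a := by
  rw [Killed, ra, rb, if_neg (by omega), if_neg (by omega)]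
  refine ⟨h.1, ?_⟩
  simp only [pr]
  omega

theorem diagEntry_eq_one (r s : K) {i a : ℕ} (hi : i < D.n) (h1 : a ≠ i) (h2 : a ≠ i + 1)
    (h3 : a ≠ 2 * D.n - i) (h4 : a ≠ 2 * D.n + 1 - i) : diagEntry D.n r s i a = 1 := by
  rw [diagEntry, if_pos hi, if_neg h1, if_neg h2, if_neg (by omega), if_neg h4]

theorem diagEntry_last_low (r s : K) {a : ℕ} (h : a + 2 ≤ D.n) :
    diagEntry D.n r s D.n a = r⁻¹ * s⁻¹ := by
  rw [diagEntry, if_neg (by omega), if_neg (by omega), if_neg (by omega), if_neg (by omega),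
    if_neg (by omega), if_pos h]

theorem diagEntry_last_high (r s : K) {a : ℕ} (h : D.n + 3 ≤ a) :
    diagEntry D.n r s D.n a = r * s := by
  rw [diagEntry, if_neg (by omega), if_neg (by omega), if_neg (by omega), if_neg (by omega),
    if_neg (by omega), if_neg (by omega)]

/-- The pairs `a < b < a'`: lower the second index from `2` to `b`, then the first from `1` to
`a`. -/
theorem twist_mem_of_lt_pr {q : K} (h : twist D q 1 2 ∈ N) (a : ℕ) (ha : 1 ≤ a) (haN : a < D.n) :
    ∀ b, a < b → b < pr D a → twist D (kap D q b) a b ∈ N := by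
  have hn := D.three_le
  induction a, ha using Nat.le_induction with
  | base =>
    intro b
    induction b using Nat.strong_induction_on with
    | _ b ih =>
      intro hb hb'
      simp only [pr] at ih hb'
      rcases lt_trichotomy b (D.n + 1) with hlt | rfl | hgt
      · rw [kap, if_pos (by omega)]
        by_cases h2 : b = 2
        · rwa [h2]
        obtain ⟨c, rfl⟩ : ∃ c, b = c + 1 := ⟨b - 1, by omega⟩
        have := twist_mem_right (by omega) (arrow_low c ⟨by omega, by omega⟩)
          (killed_of_lt (by omega) (by omega)) (ih c (by omega) (by omega) (by omega))
        rwa [diagEntry_eq_one _ _ (by omega) (by omega) (by omega) (by omega) (by omega), mul_one,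
          kap, if_pos (by omega)] at this
      · have := twist_mem_right (by omega) arrow_last
          (killed_last (by omega)) (ih (D.n - 1) (by omega) (by omega) (by omega))
        rw [diagEntry_last_low _ _ (by omega), kap, if_pos (by omega)] at this
        rwa [kap, if_neg (by omega)]
      · rw [kap, if_neg (by omega)]
        obtain ⟨c, rfl⟩ : ∃ c, b = c + 1 := ⟨b - 1, by omega⟩
        have := twist_mem_right (by omega) (arrow_high c ⟨by omega, by omega⟩)
          (killed_of_lt (by omega) (by omega)) (ih c (by omega) (by omega) (by omega))
        rwa [diagEntry_eq_one _ _ (by omega) (by omega) (by omega) (by omega) (by omega), mul_one,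
          kap, if_neg (by omega)] at this
  | succ a ha ih =>
    intro b hb hb'
    simp only [pr] at ih hb'
    have := twist_mem_left (by omega) (arrow_low a ⟨by omega, by omega⟩)
      (killed_of_lt (by omega) (by omega)) (ih (by omega) b (by omega) (by omega))
    rwa [diagEntry_eq_one _ _ (by omega) (by omega) (by omega) (by omega) (by omega), inv_one,
      mul_one] at this

/-- The pairs `m < c < m'` with second index `m'`: cross from `(m, (m+1)')` to `(m + 1, m')` by
`f_m²`, then lower the first index to `c`. For `m = n - 1`, `c = n + 1` the crossing is by
`f_n²`. -/
theorem twist_mem_pr {q : K} (h : twist D q 1 2 ∈ N) (m : ℕ) (hm : 1 ≤ m) (hmn : m < D.n) :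
    ∀ c, m < c → c < pr D m → twist D (kap D q c) c (pr D m) ∈ N := by
  have hn := D.three_le
  have hr := r_ne_zero D
  have hs := s_ne_zero D
  have hrs := r_add_s_ne_zero D
  have hrs' := r_inv_add_s_inv_ne_zero D
  intro c
  induction c using Nat.strong_induction_on with
  | _ c ih =>
    intro hc hc'
    simp only [pr] at ih hc' ⊢
    rcases lt_trichotomy c (D.n + 1) with hlt | rfl | hgt
    · rw [kap, if_pos (by omega)]
      obtain ⟨a, rfl⟩ : ∃ a, c = a + 1 := ⟨c - 1, by omega⟩
      by_cases hma : m = a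
      · subst hma
        have h1 := diagEntry_ra D D.s D.r m (by omega)
        have h2 := diagEntry_rb D D.s D.r m (by omega)
        have h3 := diagEntry_pr_ra D D.s D.r m (by omega)
        have h4 := diagEntry_pr_rb D D.s D.r m (by omega)
        rw [ra, if_pos hmn] at h1 h3
        rw [rb, if_pos hmn] at h2 h4
        have e := arrow_high (2 * D.n - m) (D := D) (by omega)
        rw [show 2 * D.n - (2 * D.n - m) = m by omega,
          show 2 * D.n - m + 1 = pr D m by simp only [pr]; omega,
          show 2 * D.n - m = pr D (m + 1) by simp only [pr]; omega] at e
        have hmem := twist_mem_of_lt_pr h m hm hmn (pr D (m + 1)) (by simp only [pr]; omega)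
          (by simp only [pr]; omega)
        have := twist_mem_sq (by omega) (arrow_low m ⟨hm, hmn⟩) e
          (by rw [h3, h4, add_comm]; exact hrs') hmem
        rw [h1, h2, h3, h4, kap, if_neg (by simp only [pr]; omega)] at this
        convert this using 2
        field_simp
      · have := twist_mem_left (by omega) (arrow_low a ⟨by omega, by omega⟩)
          (killed_of_lt (by omega) (by omega)) (ih a (by omega) (by omega) (by omega))
        rwa [diagEntry_eq_one _ _ (by omega) (by omega) (by omega) (by omega) (by omega), inv_one,
          mul_one, kap, if_pos (by omega)] at this
    · rw [kap, if_neg (by omega)]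
      by_cases hm1 : m + 1 = D.n
      · have h1 := diagEntry_ra D D.s D.r D.n (by omega)
        have h2 := diagEntry_rb D D.s D.r D.n (by omega)
        have h3 := diagEntry_pr_ra D D.s D.r D.n (by omega)
        have h4 := diagEntry_pr_rb D D.s D.r D.n (by omega)
        rw [ra, if_neg (by omega)] at h1 h3
        rw [rb, if_neg (by omega)] at h2 h4
        rw [show pr D D.n = D.n + 1 by simp only [pr]; omega] at h3
        rw [show pr D (D.n + 2) = D.n - 1 by simp only [pr]; omega] at h4
        have hmem := twist_mem_of_lt_pr h (D.n - 1) (by omega) (by omega) D.n (by omega)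
          (by simp only [pr]; omega)
        have := twist_mem_sq (by omega) arrow_last arrow_last'
          (by rw [h1, h2]; exact hrs) hmem
        rw [h1, h2, h3, h4, kap, if_pos le_rfl] at this
        rw [show 2 * D.n + 1 - m = D.n + 2 by omega]
        convert this using 2
        field_simp
      · have := twist_mem_left (by omega) arrow_last
          (killed_last (by omega)) (ih (D.n - 1) (by omega) (by omega) (by omega))
        rwa [diagEntry_last_high _ _ (by omega), kap, if_pos (by omega), mul_inv] at this
    · rw [kap, if_neg (by omega)]
      obtain ⟨a, rfl⟩ : ∃ a, c = a + 1 := ⟨c - 1, by omega⟩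
      have := twist_mem_left (by omega) (arrow_high a ⟨by omega, by omega⟩)
        (killed_of_lt (by omega) (by omega)) (ih a (by omega) (by omega) (by omega))
      rwa [diagEntry_eq_one _ _ (by omega) (by omega) (by omega) (by omega) (by omega), inv_one,
        mul_one, kap, if_neg (by omega)] at this

theorem twist_mem_of_pairsA {q : K} (h : twist D q 1 2 ∈ N) {p : ℕ × ℕ} (hp : p ∈ pairsA D.n) :
    twist D q p.1 p.2 ∈ N := by
  obtain ⟨a, b⟩ := p
  obtain ⟨h1, h2 | h2⟩ := hp
  · have := twist_mem_of_lt_pr h a (by omega) (by omega) b (by omega) (by simp only [pr]; omega)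
    rwa [kap, if_pos h2.2] at this
  · have := twist_mem_pr h (pr D b) (by simp only [pr]; omega) (by simp only [pr]; omega) a
      (by simp only [pr]; omega) (by simp only [pr]; omega)
    rwa [kap, if_pos h1.2, pr_pr D b (by omega)] at this

theorem twist_mem_of_pairsB {q : K} (h : twist D q 1 2 ∈ N) {p : ℕ × ℕ} (hp : p ∈ pairsB D.n) :
    twist D (q * (D.s⁻¹ * D.r⁻¹)) p.1 p.2 ∈ N := by
  obtain ⟨a, b⟩ := p
  rcases hp with ⟨h1, h2⟩ | ⟨h1, h2⟩
  · have := twist_mem_of_lt_pr h a (by omega) (by omega) b (by omega) (by simp only [pr]; omega)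
    rwa [kap, if_neg (by omega)] at this
  · have := twist_mem_pr h (pr D b) (by simp only [pr]; omega) (by simp only [pr]; omega) a
      (by simp only [pr]; omega) (by simp only [pr]; omega)
    rwa [kap, if_neg (by omega), pr_pr D b (by omega)] at this

/-- The image under `f_a` of the vector of weight `α_a`, at the pair `(a, (a+1)')`. -/
theorem zeroWeight_mem {q : K} (h : twist D q 1 2 ∈ N) (a : ℕ) (ha : 1 ≤ a ∧ a < D.n) :
    (-cc D) • vv D a (pr D a) + D.r⁻¹ • vv D (a + 1) (pr D (a + 1))
      + (q * (D.s⁻¹ * D.r⁻¹)) • (vv D (pr D (a + 1)) (a + 1)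
        - (D.s * cc D) • vv D (pr D a) a) ∈ N := by
  have hn := D.three_le
  have hi : 1 ≤ a ∧ a ≤ D.n := by omega
  have h1 := diagEntry_ra D D.s D.r a hi
  have h4 := diagEntry_pr_rb D D.s D.r a hi
  have f1 := fVec_ra (D := D) a hi
  have f4 := fVec_pr_rb (D := D) a hi
  simp only [ra, rb, if_pos ha.2] at h1 h4 f1 f4
  have hmem := twist_mem_of_lt_pr h a ha.1 ha.2 (pr D (a + 1)) (by simp only [pr]; omega)
    (by simp only [pr]; omega)
  have h' := N.smul_mem (U.f D (gi D a hi)) hmem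
  rw [twist, smul_add, U_smul_smul, f_gi_smul_vv, f_gi_smul_vv, f1, f4, h1, h4, tm_smul_left,
    tm_smul_right, tm_v, tm_v, tm_v, tm_v, kap, if_neg (by simp only [pr]; omega)] at h'
  convert h' using 1
  module

theorem vv_self_mem (h : vv D 1 1 ∈ N) (a : ℕ) (ha : 1 ≤ a ∧ a ≤ 2 * D.n) : vv D a a ∈ N := by
  have hn := D.three_le
  have step : ∀ i b c, 1 ≤ i ∧ i ≤ D.n → Arrow D i b c → vv D b b ∈ N → vv D c c ∈ N := by
    intro i b c hi hbc hb
    obtain ⟨d, hd, hv⟩ := hbc.exists_fVec_eq hi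
    have h' := N.smul_mem (U.f D (gi D i hi)) (N.smul_mem (U.f D (gi D i hi)) hb)
    rw [f_sq_smul_vv hi hv hv (hbc.killed hi) (hbc.killed hi)] at h'
    refine mem_of_smul_mem (mul_ne_zero (mul_ne_zero hd hd) ?_) h'
    rcases hbc with ⟨rfl, rfl⟩ | ⟨rfl, rfl⟩
    · rw [diagEntry_ra D _ _ i hi, diagEntry_rb D _ _ i hi]
      exact r_add_s_ne_zero D
    · rw [diagEntry_pr_ra D _ _ i hi, diagEntry_pr_rb D _ _ i hi, add_comm]
      exact r_inv_add_s_inv_ne_zero D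
  induction a using Nat.strong_induction_on with
  | _ a ih =>
    by_cases h1 : a = 1
    · rwa [h1]
    obtain ⟨b, rfl⟩ : ∃ b, a = b + 1 := ⟨a - 1, by omega⟩
    rcases lt_trichotomy b D.n with hlt | rfl | hgt
    · exact step b b _ (by omega) (arrow_low b ⟨by omega, hlt⟩) (ih b (by omega) (by omega))
    · exact step D.n _ _ (by omega) arrow_last (ih _ (by omega) (by omega))
    · exact step _ b _ (by omega) (arrow_high b ⟨by omega, by omega⟩) (ih b (by omega) (by omega))

variable (D)

theorem cc_mul_self : cc D * cc D = D.r⁻¹ * D.s⁻¹ := by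
  rw [cc, ← D.rh_sq, ← D.sh_sq]; ring

theorem symVectors_subset : symVectors D ⊆ Submodule.span (U D) {vv D 1 1} := by
  have hn := D.three_le
  have hr := r_ne_zero D
  have hs := s_ne_zero D
  have h11 : vv D 1 1 ∈ Submodule.span (U D) {vv D 1 1} := Submodule.mem_span_singleton_self _
  have h12 : twist D D.s 1 2 ∈ Submodule.span (U D) {vv D 1 1} := by
    have hi : 1 ≤ 1 ∧ 1 ≤ D.n := by omega
    have f1 := fVec_ra (D := D) 1 hi
    have h1 := diagEntry_ra D D.s D.r 1 hi
    simp only [ra, rb, if_pos (show 1 < D.n by omega)] at f1 h1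
    have h' := (Submodule.span (U D) {vv D 1 1}).smul_mem (U.f D (gi D 1 hi)) h11
    rwa [f_gi_smul_vv, f1, h1, tm_v, tm_v] at h'
  rintro _ (((⟨i, h1, h2, rfl⟩ | ⟨p, hp, rfl⟩) | ⟨p, hp, rfl⟩) | ⟨i, h1, h2, rfl⟩)
  · exact vv_self_mem h11 i ⟨h1, h2⟩
  · exact twist_mem_of_pairsA h12 hp
  · have := twist_mem_of_pairsB h12 hp
    rwa [mul_inv_cancel_left₀ hs] at this
  · have := zeroWeight_mem h12 i (by omega)
    refine mem_of_smul_mem (neg_ne_zero.2 (cc_ne_zero D)) ?_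
    convert this using 1
    have e1 : cc D * (D.rh⁻¹ * D.sh) = D.r⁻¹ := by
      have := sh_ne_zero D
      rw [cc, ← D.rh_sq]; field_simp
    rw [mul_inv_cancel_left₀ hs, ← e1]
    module

theorem altVectors_subset : altVectors D ∪ {vv D D.n (D.n + 1) - vv D (D.n + 1) D.n} ⊆
    (Submodule.span (U D) {vv D 1 2 - D.r • vv D 2 1} : Set (VV D)) := by
  have hn := D.three_le
  have hr := r_ne_zero D
  have hs := s_ne_zero D
  have h12 : twist D (-D.r) 1 2 ∈ Submodule.span (U D) {vv D 1 2 - D.r • vv D 2 1} := by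
    rw [twist, neg_smul, ← sub_eq_add_neg]
    exact Submodule.mem_span_singleton_self _
  have hB : -D.r * (D.s⁻¹ * D.r⁻¹) = -D.s⁻¹ := by field_simp
  have hz : ∀ i, 1 ≤ i → i ≤ D.n - 1 →
      -((D.rh⁻¹ * D.sh⁻¹) • vv D i (pr D i)) - D.s⁻¹ • vv D (pr D (i + 1)) (i + 1)
        + D.r⁻¹ • vv D (i + 1) (pr D (i + 1)) + (D.rh⁻¹ * D.sh⁻¹) • vv D (pr D i) i ∈
      Submodule.span (U D) {vv D 1 2 - D.r • vv D 2 1} := by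
    intro i h1 h2
    have := zeroWeight_mem h12 i (by omega)
    convert this using 1
    have e1 : D.s⁻¹ * (D.s * cc D) = cc D := by field_simp
    rw [hB, smul_sub, smul_smul, neg_mul, e1, cc]
    module
  rintro _ ((((⟨p, hp, rfl⟩ | ⟨p, hp, rfl⟩) | ⟨i, h1, h2, rfl⟩)) | rfl)
  · have := twist_mem_of_pairsA h12 hp
    rwa [twist, neg_smul, ← sub_eq_add_neg] at this
  · have := twist_mem_of_pairsB h12 hp
    rwa [hB, twist, neg_smul, ← sub_eq_add_neg] at this
  · exact hz i h1 h2
  -- The vector `v_n ⊗ v_{n'} - v_{n'} ⊗ v_n` is a combination of the listed vector of weight zero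
  -- for `i = n - 1` and of `f_n (v_{n-1} ⊗ v_n - r v_n ⊗ v_{n-1})`.
  · have hi : 1 ≤ D.n ∧ D.n ≤ D.n := by omega
    have f1 := fVec_ra (D := D) D.n hi
    have f2 := fVec_pr_rb (D := D) D.n hi
    have h1 := diagEntry_ra D D.s D.r D.n hi
    have h2 := diagEntry_pr_rb D D.s D.r D.n hi
    have p1 : pr D D.n = D.n + 1 := by simp only [pr]; omega
    have p2 : pr D (D.n + 2) = D.n - 1 := by simp only [pr]; omega
    have p3 : pr D (D.n - 1) = D.n + 2 := by simp only [pr]; omega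
    have p4 : D.n - 1 + 1 = D.n := by omega
    simp only [ra, rb, if_neg (lt_irrefl D.n), p1, p2] at f1 f2 h1 h2
    have hz' := hz (D.n - 1) (by omega) le_rfl
    rw [p4, p3, p1] at hz'
    have hA : twist D (-D.r) (D.n - 1) D.n ∈ Submodule.span (U D) {vv D 1 2 - D.r • vv D 2 1} :=
      twist_mem_of_pairsA h12 (p := (D.n - 1, D.n))
        ⟨by dsimp only; omega, Or.inl (by dsimp only; omega)⟩
    have h' := (Submodule.span (U D) {vv D 1 2 - D.r • vv D 2 1}).smul_mem (U.f D (gi D D.n hi)) hA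
    rw [twist, smul_add, U_smul_smul, f_gi_smul_vv, f_gi_smul_vv, f1, f2, h1, h2, tm_smul_left,
      tm_smul_right, tm_v, tm_v, tm_v, tm_v] at h'
    refine mem_of_smul_mem (r_inv_add_s_inv_ne_zero D) ?_
    convert add_mem hz' (Submodule.smul_of_tower_mem _ (cc D) h') using 1
    have e1 : cc D * D.s * cc D = D.r⁻¹ := by
      rw [mul_right_comm, cc_mul_self]; field_simp
    have e2 : cc D * D.r * cc D = D.s⁻¹ := by
      rw [mul_right_comm, cc_mul_self]; field_simp
    have e3 : cc D * (D.r * D.r⁻¹) = cc D := by field_simp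
    change _ = -(cc D • _) - _ + _ + cc D • _ + _
    linear_combination (norm := module) e1 • vv D (D.n + 1) D.n - e2 • vv D D.n (D.n + 1)
      + e3 • vv D (D.n + 2) (D.n - 1)

/-! ### The listed vectors span -/

/-- The lists of vectors spanning the three summands, in the order of `hw`. -/
def spanVectors : Fin 3 → Set (VV D) :=
  ![{omega D}, symVectors D, altVectors D ∪ {vv D D.n (D.n + 1) - vv D (D.n + 1) D.n}]

theorem pairs_of_lt {a b : ℕ} (ha : 1 ≤ a) (hab : a < b) (hb : b ≤ 2 * D.n) (h : b ≠ pr D a) :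
    (a, b) ∈ pairsA D.n ∨ (a, b) ∈ pairsB D.n := by
  simp only [pairsA, pairsB, Set.mem_ofPred_eq]
  simp only [pr] at h
  omega

variable {D}

theorem apply_vv_eq_zero_of_lt {g : VV D →ₗ[K] K} (hs : ∀ x ∈ symVectors D, g x = 0)
    (ha : ∀ x ∈ altVectors D, g x = 0) {a b : ℕ} (h1 : 1 ≤ a) (hab : a < b)
    (h2 : b ≤ 2 * D.n) (h : b ≠ pr D a) : g (vv D a b) = 0 ∧ g (vv D b a) = 0 := by
  rcases pairs_of_lt D h1 hab h2 h with hp | hp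
  · have e1 := hs _ (Or.inl (Or.inl (Or.inr ⟨_, hp, rfl⟩)))
    have e2 := ha _ (Or.inl (Or.inl ⟨_, hp, rfl⟩))
    simp only [map_add, map_sub, map_smul, smul_eq_mul] at e1 e2
    have : (D.r + D.s) * g (vv D b a) = 0 := by linear_combination e1 - e2
    have h0 := (mul_eq_zero.1 this).resolve_left (r_add_s_ne_zero D)
    exact ⟨by linear_combination e1 - D.s * h0, h0⟩
  · have e1 := hs _ (Or.inl (Or.inr ⟨_, hp, rfl⟩))
    have e2 := ha _ (Or.inl (Or.inr ⟨_, hp, rfl⟩))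
    simp only [map_add, map_sub, map_smul, smul_eq_mul] at e1 e2
    have : (D.r⁻¹ + D.s⁻¹) * g (vv D b a) = 0 := by linear_combination e1 - e2
    have h0 := (mul_eq_zero.1 this).resolve_left (r_inv_add_s_inv_ne_zero D)
    exact ⟨by linear_combination e1 - D.r⁻¹ * h0, h0⟩

theorem apply_vv_pr {g : VV D →ₗ[K] K} (hs : ∀ x ∈ symVectors D, g x = 0)
    (ha : ∀ x ∈ altVectors D, g x = 0)
    (hn : g (vv D D.n (D.n + 1) - vv D (D.n + 1) D.n) = 0) (i : ℕ) (hi : 1 ≤ i) (hin : i ≤ D.n) :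
    g (vv D i (pr D i)) = (aCoef D i)⁻¹ * g (vv D D.n (D.n + 1)) ∧
      g (vv D (pr D i) i) = aCoef D i * g (vv D D.n (D.n + 1)) := by
  have hrh := rh_ne_zero D
  have hsh := sh_ne_zero D
  induction hin using Nat.decreasingInduction with
  | self =>
    have h1 : pr D D.n = D.n + 1 := by simp only [pr]; omega
    have h2 : aCoef D D.n = 1 := by simp [aCoef, aExp]
    rw [h1, h2, inv_one, one_mul]
    rw [map_sub, sub_eq_zero] at hn
    exact ⟨rfl, hn.symm⟩
  | of_succ i hin ih =>
    obtain ⟨hP, hQ⟩ := ih (by omega)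
    have hα := aCoef_ra D i (by omega)
    rw [ra, rb, if_pos hin, if_pos hin] at hα
    have e1 := hs _ (Or.inr ⟨i, hi, by omega, rfl⟩)
    have e2 := ha _ (Or.inr ⟨i, hi, by omega, rfl⟩)
    simp only [map_add, map_sub, map_smul, map_neg, smul_eq_mul] at e1 e2
    rw [← D.rh_sq, ← D.sh_sq] at e1 e2
    have hz : D.rh ^ 2 + D.sh ^ 2 ≠ 0 := by
      rw [D.rh_sq, D.sh_sq]; exact r_add_s_ne_zero D
    generalize g (vv D i (pr D i)) = P at *
    generalize g (vv D (pr D i) i) = Q at *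
    generalize g (vv D (i + 1) (pr D (i + 1))) = P' at *
    generalize g (vv D (pr D (i + 1)) (i + 1)) = Q' at *
    have e3 : D.rh ^ 2 * P + D.sh ^ 2 * Q - D.rh * D.sh * (Q' + P') = 0 := by
      rw [← mul_zero (D.rh ^ 2), ← e1]; field_simp
    have e4 : -(D.rh * D.sh * P) - D.rh ^ 2 * Q' + D.sh ^ 2 * P' + D.rh * D.sh * Q = 0 := by
      rw [← mul_zero (D.rh ^ 2 * D.sh ^ 2), ← e2]; field_simp
    have hQ' : D.sh * Q = D.rh * Q' := by
      apply mul_left_cancel₀ hz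
      linear_combination D.sh * e3 + D.rh * e4
    have hP' : D.rh * P = D.sh * P' := by
      apply mul_left_cancel₀ hz
      linear_combination D.rh * e3 - D.sh * e4
    have hz' := aCoef_ne_zero D (i + 1)
    constructor
    · apply mul_left_cancel₀ hrh
      rw [hP', hP, hα]; field_simp
    · apply mul_left_cancel₀ hsh
      rw [hQ', hQ, hα]; field_simp

variable (D)

/-- A functional vanishing on all listed vectors of `S'` and `Λ` is a multiple of the invariant
functional, and hence is zero if it also vanishes at `ω`. -/
theorem iSup_span_spanVectors : ⨆ k, Submodule.span K (spanVectors D k) = ⊤ := by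
  by_contra hne
  obtain ⟨g, hg0, hg⟩ := Submodule.exists_le_ker_of_lt_top _ (lt_top_iff_ne_top.2 hne)
  have hz : ∀ k, ∀ x ∈ spanVectors D k, g x = 0 := fun k x hx =>
    hg (le_iSup (fun k => Submodule.span K (spanVectors D k)) k (Submodule.subset_span hx))
  have hω : g (omega D) = 0 := hz 0 _ rfl
  have hs : ∀ x ∈ symVectors D, g x = 0 := hz 1
  have ha : ∀ x ∈ altVectors D, g x = 0 := fun x hx => hz 2 x (Or.inl hx)
  have hn : g (vv D D.n (D.n + 1) - vv D (D.n + 1) D.n) = 0 := hz 2 _ (Or.inr rfl)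
  have key : g = g (vv D D.n (D.n + 1)) • trace D := by
    refine LinearMap.ext_on (span_vv D) ?_
    rintro _ ⟨a, b, ha', hb', rfl⟩
    rw [LinearMap.smul_apply, trace_vv D a b ha', smul_eq_mul]
    by_cases hab : b = pr D a
    · subst hab
      rw [if_pos rfl]
      by_cases h : a ≤ D.n
      · rw [(apply_vv_pr hs ha hn a ha'.1 h).1, mul_comm]
      · have := (apply_vv_pr hs ha hn (pr D a) (by simp only [pr]; omega)
          (by simp only [pr]; omega)).2
        rw [pr_pr D a ha', aCoef_pr D a ha'] at this
        rw [this, mul_comm]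
    · rw [if_neg hab, mul_zero]
      rcases lt_trichotomy a b with h | rfl | h
      · exact (apply_vv_eq_zero_of_lt hs ha ha'.1 h hb'.2 hab).1
      · exact hs _ (Or.inl (Or.inl (Or.inl ⟨a, ha'.1, ha'.2, rfl⟩)))
      · refine (apply_vv_eq_zero_of_lt hs ha hb'.1 h ha'.2 ?_).2
        simp only [pr] at hab ⊢
        omega
  have h0 : g (vv D D.n (D.n + 1)) = 0 := by
    have := hω
    rw [key, LinearMap.smul_apply, smul_eq_mul] at this
    exact (mul_eq_zero.1 this).resolve_right (trace_omega D)
  rw [h0, zero_smul] at key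
  exact hg0 key

theorem spanVectors_subset (k : Fin 3) :
    spanVectors D k ⊆ (Submodule.span (U D) {hw D k} : Set (VV D)) := by
  fin_cases k
  · exact Submodule.subset_span
  · exact symVectors_subset D
  · exact altVectors_subset D

theorem iSup_span_hw : ⨆ k, Submodule.span (U D) {hw D k} = ⊤ := by
  refine (Submodule.restrictScalars_eq_top_iff K (U D) (VV D)).1 (top_le_iff.1 ?_)
  rw [← iSup_span_spanVectors D]
  refine iSup_le fun k => Submodule.span_le.2 fun x hx => ?_
  exact le_iSup (fun k => Submodule.span (U D) {hw D k}) k (spanVectors_subset D k hx)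

/-- Since the listed vectors lie in independent submodules and together span `V ⊗ V`, they span
these submodules. -/
theorem restrictScalars_span_hw (k : Fin 3) :
    (Submodule.span (U D) {hw D k}).restrictScalars K = Submodule.span K (spanVectors D k) := by
  refine le_antisymm (fun x hx => ?_) (Submodule.span_le.2 (spanVectors_subset D k))
  have hle : ∀ l, Submodule.span K (spanVectors D l)
      ≤ (Submodule.span (U D) {hw D l}).restrictScalars K :=
    fun l => Submodule.span_le.2 (spanVectors_subset D l)
  have htop : x ∈ ⨆ k, Submodule.span K (spanVectors D k) := by
    rw [iSup_span_spanVectors D]; trivial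
  rw [iSup_split_single _ k] at htop
  obtain ⟨y, hy, z, hz, rfl⟩ := Submodule.mem_sup.1 htop
  have hz1 : z ∈ Submodule.span (U D) {hw D k} := by
    simpa using sub_mem hx (hle k hy)
  have hz2 : (⨆ j, ⨆ (_ : j ≠ k), Submodule.span K (spanVectors D j))
      ≤ (⨆ j, ⨆ (_ : j ≠ k), Submodule.span (U D) {hw D j}).restrictScalars K :=
    iSup₂_le fun j hj => (hle j).trans fun w hw' =>
      (le_iSup₂ (f := fun j (_ : j ≠ k) => Submodule.span (U D) {hw D j}) j hj) hw'
  have hz0 := Submodule.disjoint_def.1 (iSupIndep_span_hw D k) z hz1 (hz2 hz)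
  rwa [hz0, add_zero]

theorem isHighestWeightVector_hw (k : Fin 3) :
    IsHighestWeightVector D (Submodule.span (U D) {hw D k}) (hw D k) where
  ne_zero h := hwDual_hw_ne_zero D k (by rw [h, map_zero])
  e_smul := (isSingular_hw D k).e_smul
  w_smul i := (isSingular_hw D k).t_smul (.w i)
  w'_smul i := (isSingular_hw D k).t_smul (.w' i)
  span_eq := rfl

theorem SPrime_eq : SPrime D = Submodule.span (U D) {vv D 1 1} := by
  have hn := D.three_le
  refine le_antisymm (Submodule.span_le.2 (symVectors_subset D)) (Submodule.span_mono ?_)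
  exact Set.singleton_subset_iff.2 (Or.inl (Or.inl (Or.inl ⟨1, le_rfl, by omega, rfl⟩)))

theorem Lam_eq : Lam D = Submodule.span (U D) {vv D 1 2 - D.r • vv D 2 1} := by
  have hn := D.three_le
  refine le_antisymm (Submodule.span_le.2 (Set.subset_union_left.trans (altVectors_subset D)))
    (Submodule.span_mono ?_)
  exact Set.singleton_subset_iff.2 (Or.inl (Or.inl ⟨(1, 2),
    ⟨by dsimp only; omega, Or.inl (by dsimp only; omega)⟩, rfl⟩))

end TwoParamD

end

theorem lemma3p6 {K : Type*} [Field K] [CharZero K] (D : TwoParamD.Datum K) :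
    DirectSum.IsInternal ![TwoParamD.SO D, TwoParamD.SPrime D, TwoParamD.Lam D] ∧
    IsSimpleModule (TwoParamD.U D) (TwoParamD.SO D) ∧
    IsSimpleModule (TwoParamD.U D) (TwoParamD.SPrime D) ∧
    IsSimpleModule (TwoParamD.U D) (TwoParamD.Lam D) ∧
    Module.finrank K (TwoParamD.SO D) = 1 ∧
    (TwoParamD.SO D).restrictScalars K = Submodule.span K {TwoParamD.omega D} ∧
    (TwoParamD.SPrime D).restrictScalars K = Submodule.span K (TwoParamD.symVectors D) ∧
    (TwoParamD.Lam D).restrictScalars K = Submodule.span K (TwoParamD.altVectors D ∪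
      {TwoParamD.vv D D.n (D.n + 1) - TwoParamD.vv D (D.n + 1) D.n}) ∧
    TwoParamD.IsHighestWeightVector D (TwoParamD.SPrime D) (TwoParamD.vv D 1 1) ∧
    TwoParamD.IsHighestWeightVector D (TwoParamD.Lam D)
      (TwoParamD.vv D 1 2 - D.r • TwoParamD.vv D 2 1) := by
  have hfam : ![TwoParamD.SO D, TwoParamD.SPrime D, TwoParamD.Lam D]
      = fun k => Submodule.span (TwoParamD.U D) {TwoParamD.hw D k} := by
    funext k
    fin_cases k
    exacts [rfl, TwoParamD.SPrime_eq D, TwoParamD.Lam_eq D]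
  have hSO := TwoParamD.restrictScalars_span_hw D 0
  refine ⟨?_, ?_, ?_, ?_, ?_, hSO, ?_, ?_, ?_, ?_⟩
  · rw [hfam]
    exact (DirectSum.isInternal_submodule_iff_iSupIndep_and_iSup_eq_top _).2
      ⟨TwoParamD.iSupIndep_span_hw D, TwoParamD.iSup_span_hw D⟩
  · exact isSimpleModule_iff_isAtom.2 (TwoParamD.isAtom_span_hw D 0)
  · rw [TwoParamD.SPrime_eq]
    exact isSimpleModule_iff_isAtom.2 (TwoParamD.isAtom_span_hw D 1)
  · rw [TwoParamD.Lam_eq]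
    exact isSimpleModule_iff_isAtom.2 (TwoParamD.isAtom_span_hw D 2)
  · change Module.finrank K ((TwoParamD.SO D).restrictScalars K) = 1
    refine (congrArg (fun N : Submodule K (TwoParamD.VV D) => Module.finrank K N) hSO).trans ?_
    exact finrank_span_singleton (TwoParamD.isHighestWeightVector_hw D 0).ne_zero
  · rw [TwoParamD.SPrime_eq]
    exact TwoParamD.restrictScalars_span_hw D 1
  · rw [TwoParamD.Lam_eq]
    exact TwoParamD.restrictScalars_span_hw D 2
  · rw [TwoParamD.SPrime_eq]
    exact TwoParamD.isHighestWeightVector_hw D 1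
  · rw [TwoParamD.Lam_eq]
    exact TwoParamD.isHighestWeightVector_hw D 2
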